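/- A graph is a finite CW complex of dimension at most $1$ (loops and multiple edges are allowed). For a space $X$, $\mathrm{Conf}_2(X)=\{(x_1,x_2)\in X^2 : x_1\neq x_2\}$, and for a subset $W\subseteq X$ (the sinks), $\mathrm{Conf}_2(X,W)=\{(x_1,x_2)\in X^2 : x_1\ne x_2 \text{ or } x_1=x_2\in W\}$, both with the subspace topology. Let $G$ be a connected graph and let $v$ be an articulation of $G$, that is, a vertex such that the space $G-\{v\}$ is disconnected. Let $G_v\subseteq G$ be a subspace homeomorphic to the letter Y, with its essential vertex at $v$, such that $G_v-\{v\}$ meets at least two connected components of $G-\{v\}$. Let $E_v$ be the union of all closed edges of $G$ that are not incident to $v$, and let $q\colon G\to\overline{G}_v$ be the quotient map that collapses each connected component of $E_v$ to a point. Then: 1. The map $H_1(\mathrm{Conf}_2(G_v);\mathbb{Z})\to H_1(\mathrm{Conf}_2(G);\mathbb{Z})$ induced by the inclusion is injective. 2. $\mathrm{Conf}_2(G_v)$ is homotopy equivalent to the circle. 3. $\overline{G}_v$ is a graph whose vertices may be taken to be the images of the vertices of $G$ together with the images of the midpoints of the loops of $G$ at $v$. Let $W_v$ be the set of all these vertices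 except $q(v)$. Then $q(x)\in W_v$ whenever $q(x)=q(y)$ for some $y\neq x$, so $q$ induces a map $\mathrm{Conf}_2(G)\to\mathrm{Conf}_2(\overline{G}_v,W_v)$, and the composite $$H_1(\mathrm{Conf}_2(G_v);\mathbb{Z})\to H_1(\mathrm{Conf}_2(G);\mathbb{Z})\to H_1(\mathrm{Conf}_2(\overline{G}_v,W_v);\mathbb{Z})$$ is injective, and its image has rank $1$. -/

import Mathlib

open Set Topology

noncomputable section

/-! ### Configuration spaces, with and without sinks -/

/-- The ordered configuration space `Conf_n(X)`: injective maps `{1, …, n} → X`, with the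
subspace topology of `X ^ n`. -/
abbrev Conf (n : ℕ) (X : Type) : Type :=
  {x : Fin n → X // Function.Injective x}

/-- The configuration space with sinks `Conf_n(X, W)`: particles may collide only in `W`. -/
abbrev ConfSink (n : ℕ) (X : Type) (W : Set X) : Type :=
  {x : Fin n → X // ∀ i j, i ≠ j → x i ≠ x j ∨ (x i = x j ∧ x i ∈ W)}

/-- The map `Conf_n(A) → Conf_n(X)` induced by the inclusion of a subspace `A ⊆ X`. -/
def Conf.incl (n : ℕ) {X : Type} [TopologicalSpace X] (A : Set X) : C(Conf n A, Conf n X) where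
  toFun x := ⟨fun i => (x.1 i : X), Subtype.val_injective.comp x.2⟩
  continuous_toFun := Continuous.subtype_mk (continuous_pi fun i =>
    continuous_subtype_val.comp ((continuous_apply i).comp continuous_subtype_val)) _

/-- The map `Conf_n(X) → Conf_n(Y, W)` induced by a map `q : X → Y` which identifies distinct
points only when their common image is a sink. -/
def Conf.toSink (n : ℕ) {X Y : Type} [TopologicalSpace X] [TopologicalSpace Y] (q : C(X, Y))
    (W : Set Y) (hq : ∀ x y, x ≠ y → q x = q y → q x ∈ W) : C(Conf n X, ConfSink n Y W) where
  toFun x := ⟨fun i => q (x.1 i), fun i j hij => by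
    by_cases h : q (x.1 i) = q (x.1 j)
    · exact Or.inr ⟨h, hq _ _ (fun h' => hij (x.2 h')) h⟩
    · exact Or.inl h⟩
  continuous_toFun := Continuous.subtype_mk (continuous_pi fun i =>
    q.continuous.comp ((continuous_apply i).comp continuous_subtype_val)) _

/-! ### First integral singular homology -/

/-- The first singular homology group `H_1(X; ℤ)`. -/
abbrev H1 (X : Type) [TopologicalSpace X] : ModuleCat.{0} ℤ :=
  ((AlgebraicTopology.singularHomologyFunctor (ModuleCat.{0} ℤ) 1).obj
    (ModuleCat.of ℤ ℤ)).obj (TopCat.of X)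

/-- The homomorphism `H_1(X; ℤ) → H_1(Y; ℤ)` induced by a continuous map. -/
def H1.map {X Y : Type} [TopologicalSpace X] [TopologicalSpace Y] (f : C(X, Y)) :
    H1 X →ₗ[ℤ] H1 Y :=
  (((AlgebraicTopology.singularHomologyFunctor (ModuleCat.{0} ℤ) 1).obj
    (ModuleCat.of ℤ ℤ)).map (TopCat.ofHom f)).hom

/-! ### Graphs -/

section Graph

open RelCWComplex

variable (G : Type) [TopologicalSpace G] [CWComplex (univ : Set G)]

/-- A finite graph: a (Hausdorff) CW complex of dimension at most one with finitely many cells.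
Loops and multiple edges are allowed. -/
structure IsFiniteGraph : Prop where
  t2 : T2Space G
  finite : RelCWComplex.Finite (univ : Set G)
  dim_le_one : ∀ n, 2 ≤ n → IsEmpty (cell (univ : Set G) n)

/-- The set of vertices (0-cells), as a set of points of the graph. -/
def vertexSet : Set G :=
  ⋃ x : cell (univ : Set G) 0, closedCell 0 x

variable {G}

/-- A vertex `v` is an articulation if removing it makes the graph disconnected. -/
def IsArticulation (v : G) : Prop :=
  v ∈ vertexSet G ∧ ¬ IsPreconnected ({v}ᶜ : Set G)

/-- The union of all (closed) edges that are not incident to `v`. -/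
def nonincidentEdges (v : G) : Set G :=
  ⋃ (e : cell (univ : Set G) 1) (_ : v ∉ cellFrontier 1 e), closedCell 1 e

/-- The midpoints of the edges that form a loop at `v`. -/
def loopMidpoints (v : G) : Set G :=
  {p | ∃ e : cell (univ : Set G) 1, cellFrontier 1 e = {v} ∧ p = map 1 e 0}

/-- `q : G → Q` exhibits the graph `Q` with set of sinks `W` as the graph obtained from `G` by
collapsing all edges not incident to `v` (each component of their union to one point), and adding
an artificial vertex in the middle of each loop at `v`; the sinks are all vertices of
this graph except for `v`. -/
structure IsSinkCollapse {Q : Type} [TopologicalSpace Q] [CWComplex (univ : Set Q)]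
    (v : G) (q : C(G, Q)) (W : Set Q) : Prop where
  isQuotientMap : IsQuotientMap q
  eq_iff : ∀ x y, q x = q y ↔ x = y ∨
    (x ∈ nonincidentEdges v ∧ y ∈ nonincidentEdges v ∧
      connectedComponentIn (nonincidentEdges v) x = connectedComponentIn (nonincidentEdges v) y)
  vertexSet_eq : vertexSet Q = q '' (vertexSet G ∪ loopMidpoints v)
  sinks_eq : W = vertexSet Q \ {q v}
  mem_sinks : ∀ x y, x ≠ y → q x = q y → q x ∈ W

end Graph

/-! ### Y-graphs -/

/-- The graph shaped like the letter Y: three unit intervals glued at the point `0`. -/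
def letterY : Set (Fin 3 → ℝ) :=
  {x | ∃ (i : Fin 3) (t : ℝ), t ∈ Icc (0 : ℝ) 1 ∧ x = Pi.single i t}

/-- The essential vertex of the letter Y. -/
def letterY.center : letterY :=
  ⟨0, 0, 0, by simp, by simp⟩

/-- `A ⊆ X` is a Y-graph embedded in `X` whose essential vertex is `v`. -/
def IsYGraphAround {X : Type} [TopologicalSpace X] (A : Set X) (v : X) : Prop :=
  ∃ φ : letterY ≃ₜ A, (φ letterY.center : X) = v

/-- `A - {v}` meets at least two connected components of `X - {v}`. -/
def MeetsTwoComponents {X : Type} [TopologicalSpace X] (A : Set X) (v : X) : Prop :=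
  ∃ a ∈ A \ {v}, ∃ b ∈ A \ {v},
    connectedComponentIn ({v}ᶜ : Set X) a ≠ connectedComponentIn ({v}ᶜ : Set X) b

end

/-!
The homology class of the loop in which two particles on a Y-graph exchange their positions twice
is detected by a map from the configuration space with sinks to the circle.

*The letter Y.* The direction of the difference of two particles, projected along the diagonal of
`ℝ ^ 3` to a plane, is a map from the configuration space of the letter Y to the circle
(`confYDirection`). It is a homotopy inverse of the explicit loop `exchangeLoop`: two particles on
one arm are moved to the centre until one of them gets there, and the resulting configuration is
determined by the direction up to scale (`circleHomotopyEquivConfY`). The second claim follows.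

*The homology of the circle.* Mathlib provides singular homology and its homotopy invariance. For
the circle, simplices are lifted along the exponential covering of the circle by the line. The
displacement of the lift is a cocycle, hence a winding number on one-chains modulo boundaries, and
joining every point to `1` by an arc shows that every cycle is homologous to a multiple of the full
turn (`nonempty_addEquiv_H1_circle`).

*The quotient graph.* The half-edges at `v`, where loops are cut in the middle, form a star:
finitely many rays that issue from `v`, whose interiors are disjoint and open, and which together
with the vertices and the closed set of edges not incident to `v` cover the graph
(`isStar_halfEdge`).
Collapsing the finitely many components of the non-incident edges is a closed map, so the quotient
is Hausdorff, and it is a star without rest, that is, a graph whose edges are the rays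
(`exists_cwComplex_isSinkCollapse`).

*Detection.* The arms of the Y-graph start in three different rays `a`, `b`, `c` of the star,
labelled such that `b` and `c` are in different components of the complement of `v`; therefore `b`
and `c` have different ends in the quotient. Functions on the quotient can be defined ray by ray.
Let `σ` have values in the unit circle of `ℂ`, equal to `1` at `v` only, turning through the upper
half-plane on `a` and through the lower half-plane on all other rays. Let `t` have values in
`[-1, 1]`, equal to `0` at `v` only, positive on the rays that end where `c` does and negative on
the others. Then `σ x - 1 + t y` vanishes only for `x = y = v`, which is not a sink, so its
direction is a map on the configuration space with sinks. Along a small exchange loop it is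
homotopic to a reflection of the circle (`homotopic_circleReflection`). Hence the composite on `H_1`
is injective, which also gives the first claim, and its image is isomorphic to `H_1` of the circle.
-/

noncomputable section

/-! ### One-chains modulo boundaries -/

open CategoryTheory Simplicial in
/-- The singular chain complex of `X` with integral coefficients. -/
def singularComplex (X : Type) [TopologicalSpace X] : ChainComplex (ModuleCat.{0} ℤ) ℕ :=
  (TopCat.toSSet.obj (TopCat.of X)).chainComplex (ModuleCat.of ℤ ℤ)

open Simplicial in
/-- The set of singular `n`-simplices of `X`. -/
abbrev Simplices (X : Type) [TopologicalSpace X] (n : ℕ) : Type :=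
  (TopCat.toSSet.obj (TopCat.of X)) _⦋n⦌

/-- Singular one-chains of `X` modulo boundaries; `H_1(X)` is the submodule of the classes of
cycles. -/
abbrev ChainsModBoundaries (X : Type) [TopologicalSpace X] : ModuleCat.{0} ℤ :=
  (singularComplex X).opcycles 1

section Chains

open CategoryTheory Simplicial

variable {X Y : Type} [TopologicalSpace X] [TopologicalSpace Y]

/-- The `i`-th face of a singular simplex. -/
def Simplices.face {n : ℕ} (i : Fin (n + 2)) (σ : Simplices X (n + 1)) : Simplices X n :=
  (TopCat.toSSet.obj (TopCat.of X)).δ i σ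

/-- The simplex obtained by composing a simplex with a continuous map. -/
def Simplices.map (f : C(X, Y)) {n : ℕ} (σ : Simplices X n) : Simplices Y n :=
  (TopCat.toSSet.map (TopCat.ofHom f)).app _ σ

lemma Simplices.face_map (f : C(X, Y)) {n : ℕ} (i : Fin (n + 2)) (σ : Simplices X (n + 1)) :
    (σ.map f).face i = (σ.face i).map f :=
  (SSet.δ_naturality_apply _ _ _).symm

/-- A singular simplex, as a morphism from `ℤ` to the module of chains. -/
def simplexHom {n : ℕ} (σ : Simplices X n) : ModuleCat.of ℤ ℤ ⟶ (singularComplex X).X n :=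
  SSet.ιChainComplex (R := ModuleCat.of ℤ ℤ) _ σ

/-- A singular simplex, as a chain. -/
def simplexChain {n : ℕ} (σ : Simplices X n) : (singularComplex X).X n :=
  (simplexHom σ).hom (1 : ℤ)

/-- Linear maps out of the module of singular chains are determined by their values on
simplices. -/
lemma chain_hom_ext {n : ℕ} {N : Type} [AddCommGroup N] [Module ℤ N]
    {f g : (singularComplex X).X n →ₗ[ℤ] N}
    (h : ∀ σ : Simplices X n, f (simplexChain σ) = g (simplexChain σ)) : f = g := by
  have : ModuleCat.ofHom f = ModuleCat.ofHom g := by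
    apply SSet.chainComplex_hom_ext
    intro σ
    ext
    exact h σ
  simpa using congrArg ModuleCat.Hom.hom this

/-- The linear map on singular chains with prescribed values on simplices. -/
lemma exists_linearMap_simplexChain {n : ℕ} {N : Type} [AddCommGroup N] [Module ℤ N]
    (φ : Simplices X n → N) :
    ∃ f : (singularComplex X).X n →ₗ[ℤ] N, ∀ σ, f (simplexChain σ) = φ σ := by
  refine ⟨(Limits.Sigma.desc (f := fun _ : Simplices X n => ModuleCat.of ℤ ℤ)
    (P := ModuleCat.of ℤ N) fun σ => ModuleCat.ofHom (LinearMap.toSpanSingleton ℤ N (φ σ))).hom,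
    fun σ => ?_⟩
  refine (ConcreteCategory.congr_hom (Limits.Sigma.ι_desc
    (f := fun _ : Simplices X n => ModuleCat.of ℤ ℤ) (P := ModuleCat.of ℤ N)
    (fun σ => ModuleCat.ofHom (LinearMap.toSpanSingleton ℤ N (φ σ))) σ) (1 : ℤ)).trans ?_
  exact LinearMap.toSpanSingleton_apply_one ℤ N (φ σ)

lemma simplexHom_d {n : ℕ} (σ : Simplices X (n + 1)) :
    simplexHom σ ≫ (singularComplex X).d (n + 1) n =
      ∑ i : Fin (n + 2), (-1 : ℤ) ^ i.val • simplexHom (σ.face i) :=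
  SSet.ιChainComplex_d (TopCat.toSSet.obj (TopCat.of X)) (R := ModuleCat.of ℤ ℤ) σ

lemma d_simplexChain_one (σ : Simplices X 1) :
    ((singularComplex X).d 1 0).hom (simplexChain σ) =
      simplexChain (σ.face 0) - simplexChain (σ.face 1) := by
  have := ConcreteCategory.congr_hom (simplexHom_d σ) (1 : ℤ)
  simp only [Fin.sum_univ_succ] at this
  refine this.trans ?_
  simp [simplexChain, sub_eq_add_neg]

lemma d_simplexChain_two (σ : Simplices X 2) :
    ((singularComplex X).d 2 1).hom (simplexChain σ) =
      simplexChain (σ.face 0) - simplexChain (σ.face 1) + simplexChain (σ.face 2) := by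
  have := ConcreteCategory.congr_hom (simplexHom_d σ) (1 : ℤ)
  simp only [Fin.sum_univ_succ] at this
  refine this.trans ?_
  simp [simplexChain, sub_eq_add_neg, add_assoc]

/-- The class of a one-simplex modulo boundaries. -/
def simplexClass (σ : Simplices X 1) : ChainsModBoundaries X :=
  ((singularComplex X).pOpcycles 1).hom (simplexChain σ)

lemma chainsModBoundaries_hom_ext {N : Type} [AddCommGroup N] {f g : ChainsModBoundaries X →+ N}
    (h : ∀ σ : Simplices X 1, f (simplexClass σ) = g (simplexClass σ)) : f = g := by
  -- Additive maps are linear for whichever `ℤ`-module structure the category of modules records.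
  let toLin (f : ChainsModBoundaries X →+ N) : ChainsModBoundaries X →ₗ[ℤ] N :=
    { f with map_smul' := fun n x => by simpa using map_intCast_smul f ℤ ℤ n x }
  have h1 : toLin f ∘ₗ ((singularComplex X).pOpcycles 1).hom =
      toLin g ∘ₗ ((singularComplex X).pOpcycles 1).hom := chain_hom_ext h
  have hs : Function.Surjective ((singularComplex X).pOpcycles 1).hom :=
    (ModuleCat.epi_iff_surjective _).1 inferInstance
  have h2 := (LinearMap.cancel_right hs).1 h1
  exact AddMonoidHom.ext fun x => LinearMap.congr_fun h2 x

/-- A one-cocycle on `X` induces a linear map on one-chains modulo boundaries. -/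
lemma exists_linearMap_of_cocycle {N : Type} [AddCommGroup N] [Module ℤ N] (φ : Simplices X 1 → N)
    (hφ : ∀ τ : Simplices X 2, φ (τ.face 0) - φ (τ.face 1) + φ (τ.face 2) = 0) :
    ∃ f : ChainsModBoundaries X →ₗ[ℤ] N, ∀ σ, f (simplexClass σ) = φ σ := by
  obtain ⟨g, hg⟩ := exists_linearMap_simplexChain φ
  have hk : (singularComplex X).d 2 1 ≫ ModuleCat.ofHom (Y := N) g = 0 := by
    apply ModuleCat.hom_ext
    refine chain_hom_ext fun τ => ?_
    change g (((singularComplex X).d 2 1).hom (simplexChain τ)) = 0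
    rw [d_simplexChain_two, map_add, map_sub, hg, hg, hg, hφ]
  refine ⟨((singularComplex X).descOpcycles _ 2 (by simp) hk).hom, fun σ => ?_⟩
  rw [← hg]
  exact ConcreteCategory.congr_hom ((singularComplex X).p_descOpcycles _ 2 (by simp) hk)
    (simplexChain σ)

/-- The boundary of a one-chain, which depends only on its class. -/
def boundary (X : Type) [TopologicalSpace X] :
    ChainsModBoundaries X →ₗ[ℤ] (singularComplex X).X 0 :=
  ((singularComplex X).fromOpcycles 1 0).hom

lemma boundary_simplexClass (σ : Simplices X 1) :
    boundary X (simplexClass σ) = simplexChain (σ.face 0) - simplexChain (σ.face 1) := by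
  rw [← d_simplexChain_one]
  exact ConcreteCategory.congr_hom ((singularComplex X).p_fromOpcycles 1 0) (simplexChain σ)

/-- The chain map induced by a continuous map. -/
def singularComplexMap (f : C(X, Y)) : singularComplex X ⟶ singularComplex Y :=
  SSet.chainComplexMap (TopCat.toSSet.map (TopCat.ofHom f)) (ModuleCat.of ℤ ℤ)

/-- The map on one-chains modulo boundaries induced by a continuous map. -/
def chainsMap (f : C(X, Y)) : ChainsModBoundaries X →ₗ[ℤ] ChainsModBoundaries Y :=
  (HomologicalComplex.opcyclesMap (singularComplexMap f) 1).hom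

lemma chainsMap_simplexClass (f : C(X, Y)) (σ : Simplices X 1) :
    chainsMap f (simplexClass σ) = simplexClass (σ.map f) := by
  have h1 := ConcreteCategory.congr_hom (HomologicalComplex.p_opcyclesMap
    (singularComplexMap f) 1) (simplexChain σ)
  have h2 : (singularComplexMap f).f 1 (simplexChain σ) = simplexChain (σ.map f) :=
    ConcreteCategory.congr_hom (SSet.ι_chainComplexMap_f _ _
      (f := TopCat.toSSet.map (TopCat.ofHom f)) (R := ModuleCat.of ℤ ℤ) σ) (1 : ℤ)
  refine h1.trans ?_
  simp only [ModuleCat.hom_comp, LinearMap.comp_apply]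
  exact congrArg _ h2

/-- The inclusion of `H_1` into the one-chains modulo boundaries. -/
def homologyInclusion (X : Type) [TopologicalSpace X] : H1 X →ₗ[ℤ] ChainsModBoundaries X :=
  ((singularComplex X).homologyι 1).hom

lemma homologyInclusion_injective : Function.Injective (homologyInclusion X) :=
  (ModuleCat.mono_iff_injective ((singularComplex X).homologyι 1)).1 inferInstance

lemma exact_homologyInclusion_boundary :
    Function.Exact (homologyInclusion X) (boundary X) := by
  have hz := (singularComplex X).homologyι_comp_fromOpcycles 1 0
  have := (ShortComplex.mk _ _ hz).exact_of_f_is_kernel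
    ((singularComplex X).homologyIsKernel 1 0 (by simp))
  exact (ShortComplex.ShortExact.moduleCat_exact_iff_function_exact _).1 this

end Chains

/-! ### Functoriality and homotopy invariance -/

section Functoriality

open CategoryTheory

variable {X Y Z : Type} [TopologicalSpace X] [TopologicalSpace Y] [TopologicalSpace Z]

lemma H1.map_comp (g : C(Y, Z)) (f : C(X, Y)) :
    H1.map (g.comp f) = (H1.map g).comp (H1.map f) := by
  unfold H1.map
  rw [TopCat.ofHom_comp, Functor.map_comp]
  rfl

lemma H1.map_id : H1.map (ContinuousMap.id X) = LinearMap.id := by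
  unfold H1.map
  exact congrArg ModuleCat.Hom.hom (CategoryTheory.Functor.map_id _ (TopCat.of X))

lemma H1.map_eq_of_homotopic {f g : C(X, Y)} (h : f.Homotopic g) : H1.map f = H1.map g := by
  obtain ⟨H⟩ := h
  exact congrArg ModuleCat.Hom.hom (TopCat.Homotopy.congr_homologyMap_singularChainComplexFunctor
    (f := TopCat.ofHom f) (g := TopCat.ofHom g) H (ModuleCat.of ℤ ℤ) 1)

/-- A homotopy equivalence induces an isomorphism on `H_1`. -/
def H1.equiv (e : ContinuousMap.HomotopyEquiv X Y) : H1 X ≃ₗ[ℤ] H1 Y :=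
  LinearEquiv.ofLinearMap (H1.map e.toFun) (H1.map e.invFun)
    (by rw [← H1.map_comp, H1.map_eq_of_homotopic e.right_inv, H1.map_id])
    (by rw [← H1.map_comp, H1.map_eq_of_homotopic e.left_inv, H1.map_id])

lemma H1.map_injective_of_homotopyEquiv (e : ContinuousMap.HomotopyEquiv X Y) :
    Function.Injective (H1.map e.toFun) :=
  (H1.equiv e).injective

lemma H1.subsingleton_of_contractible [ContractibleSpace X] : Subsingleton (H1 X) := by
  obtain ⟨e⟩ := ContractibleSpace.hequiv_unit X
  have : Subsingleton (H1 Unit) := ModuleCat.subsingleton_of_isZero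
    (AlgebraicTopology.isZero_singularHomologyFunctor_of_totallyDisconnectedSpace
      _ 1 (ModuleCat.of ℤ ℤ) (TopCat.of Unit) one_ne_zero)
  exact (H1.equiv e).injective.subsingleton

lemma boundary_injective_of_contractible [ContractibleSpace X] :
    Function.Injective (boundary X) := by
  have := H1.subsingleton_of_contractible (X := X)
  rw [injective_iff_map_eq_zero]
  intro a ha
  obtain ⟨b, rfl⟩ := (exact_homologyInclusion_boundary a).1 ha
  rw [Subsingleton.elim b 0, map_zero]

end Functoriality

/-! ### The first homology of the circle -/

section Paths

open CategoryTheory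

variable {X Y : Type} [TopologicalSpace X] [TopologicalSpace Y]

/-- A point, as a singular `0`-simplex. -/
def pointSimplex (x : X) : Simplices X 0 :=
  (TopCat.toSSetObj₀Equiv (X := TopCat.of X)).symm x

/-- The point underlying a singular `0`-simplex. -/
def Simplices.point (σ : Simplices X 0) : X :=
  TopCat.toSSetObj₀Equiv (X := TopCat.of X) σ

@[simp]
lemma pointSimplex_point (σ : Simplices X 0) : pointSimplex σ.point = σ :=
  (TopCat.toSSetObj₀Equiv (X := TopCat.of X)).symm_apply_apply σ

@[simp]
lemma point_pointSimplex (x : X) : (pointSimplex x).point = x :=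
  (TopCat.toSSetObj₀Equiv (X := TopCat.of X)).apply_symm_apply x

@[simp]
lemma Simplices.point_map (f : C(X, Y)) (σ : Simplices X 0) : (σ.map f).point = f σ.point :=
  rfl

/-- The restriction of a continuous map to the unit interval, as a singular `1`-simplex. -/
def pathSimplex (γ : C(ℝ, X)) : Simplices X 1 :=
  (TopCat.toSSetObj₁Equiv (X := TopCat.of X)).symm
    (TopCat.ofHom (γ.comp ((ContinuousMap.mk Subtype.val).comp
      (toContinuousMap TopCat.I.homeomorph))))

@[simp]
lemma pathSimplex_face_zero (γ : C(ℝ, X)) : (pathSimplex γ).face 0 = pointSimplex (γ 1) := by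
  refine (TopCat.δ_zero_toSSetObj₁Equiv.symm _).trans ?_
  rfl

@[simp]
lemma pathSimplex_face_one (γ : C(ℝ, X)) : (pathSimplex γ).face 1 = pointSimplex (γ 0) := by
  refine (TopCat.δ_one_toSSetObj₁Equiv.symm _).trans ?_
  rfl

lemma pathSimplex_map (f : C(X, Y)) (γ : C(ℝ, X)) :
    (pathSimplex γ).map f = pathSimplex (f.comp γ) :=
  rfl

/-- The affine path from `a` to `b`, as a class of one-chains of the line modulo boundaries. -/
def segmentClass (a b : ℝ) : ChainsModBoundaries ℝ :=
  simplexClass (pathSimplex ⟨fun t => a + t * (b - a), by fun_prop⟩)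

lemma boundary_segmentClass (a b : ℝ) : boundary ℝ (segmentClass a b) =
    simplexChain (pointSimplex b) - simplexChain (pointSimplex a) := by
  simp [segmentClass, boundary_simplexClass]

lemma segmentClass_add (a b c : ℝ) :
    segmentClass a b + segmentClass b c = segmentClass a c := by
  apply boundary_injective_of_contractible
  simp [boundary_segmentClass]

lemma simplexClass_eq_segmentClass (τ : Simplices ℝ 1) :
    simplexClass τ = segmentClass (τ.face 1).point (τ.face 0).point := by
  apply boundary_injective_of_contractible
  simp [boundary_segmentClass, boundary_simplexClass]

/-- The class modulo boundaries of the arc of length `x` starting at `1` in the circle. -/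
def arcClass (x : ℝ) : ChainsModBoundaries Circle :=
  chainsMap Circle.exp (segmentClass 0 x)

lemma chainsMap_segmentClass (a b : ℝ) :
    chainsMap Circle.exp (segmentClass a b) = arcClass b - arcClass a := by
  rw [eq_sub_iff_add_eq', arcClass, arcClass, ← map_add, segmentClass_add]

lemma arcClass_add_two_pi (x : ℝ) :
    arcClass (x + 2 * Real.pi) = arcClass (2 * Real.pi) + arcClass x := by
  have h : chainsMap Circle.exp (segmentClass (2 * Real.pi) (x + 2 * Real.pi)) = arcClass x := by
    rw [arcClass, segmentClass, segmentClass, chainsMap_simplexClass, chainsMap_simplexClass,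
      pathSimplex_map, pathSimplex_map]
    congr 2
    ext t : 1
    simp [Circle.exp_add, Circle.exp_two_pi]
  rw [← h, chainsMap_segmentClass]
  abel

lemma arcClass_add_zsmul_two_pi (x : ℝ) (n : ℤ) :
    arcClass (x + n * (2 * Real.pi)) = n • arcClass (2 * Real.pi) + arcClass x := by
  induction n using Int.induction_on with
  | zero => simp
  | succ n ih =>
    rw [show x + ((n + 1 : ℤ) : ℝ) * (2 * Real.pi) =
      (x + (n : ℤ) * (2 * Real.pi)) + 2 * Real.pi by push_cast; ring, arcClass_add_two_pi, ih,
      add_zsmul, one_zsmul]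
    abel
  | pred n ih =>
    have := arcClass_add_two_pi (x + ((-n - 1 : ℤ) : ℝ) * (2 * Real.pi))
    rw [show x + ((-n - 1 : ℤ) : ℝ) * (2 * Real.pi) + 2 * Real.pi =
      x + (-n : ℤ) * (2 * Real.pi) by push_cast; ring, ih] at this
    rw [eq_sub_iff_add_eq'.2 this.symm, sub_zsmul, one_zsmul]
    abel

/-- Every singular simplex of the circle lifts to the line, since simplices are simply
connected. -/
lemma exists_lift_simplex {n : ℕ} (σ : Simplices Circle n) :
    ∃ τ : Simplices ℝ n, τ.map Circle.exp = σ := by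
  let e := fun (X : TopCat.{0}) => TopCat.toSSetObjEquiv X (.op (SimplexCategory.mk n))
  have hc : Convex ℝ (stdSimplex ℝ (Fin (n + 1))) := convex_stdSimplex ℝ _
  have hne : (stdSimplex ℝ (Fin (n + 1))).Nonempty := ⟨_, single_mem_stdSimplex ℝ 0⟩
  have := hc.contractibleSpace hne
  have := hc.locallyPathConnectedSpace
  obtain ⟨x, hx⟩ := hne
  obtain ⟨y, hy⟩ := Circle.exp_surjective (e (TopCat.of Circle) σ ⟨x, hx⟩)
  obtain ⟨F, ⟨-, hF⟩, -⟩ := Circle.isCoveringMap_exp.existsUnique_continuousMap_lifts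
    (e (TopCat.of Circle) σ) ⟨x, hx⟩ y hy
  refine ⟨(e (TopCat.of ℝ)).symm F, (e (TopCat.of Circle)).injective ?_⟩
  ext1 t
  exact congrFun hF t

/-- The displacement along a path in the line is determined by its image in the circle. -/
lemma displacement_eq_of_map_exp_eq {τ τ' : Simplices ℝ 1}
    (h : τ.map Circle.exp = τ'.map Circle.exp) :
    (τ.face 0).point - (τ.face 1).point = (τ'.face 0).point - (τ'.face 1).point := by
  let e := TopCat.toSSetObj₁Equiv (X := TopCat.of ℝ)
  have h0 (τ : Simplices ℝ 1) : e τ 0 = (τ.face 1).point := TopCat.toSSetObj₁Equiv_apply_zero τ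
  have h1 (τ : Simplices ℝ 1) : e τ 1 = (τ.face 0).point := TopCat.toSSetObj₁Equiv_apply_one τ
  have hexp (t) : Circle.exp (e τ t) = Circle.exp (e τ' t) :=
    congrArg (fun σ => TopCat.toSSetObj₁Equiv (X := TopCat.of Circle) σ t) h
  rw [← h0, ← h1, ← h0, ← h1]
  have hconn : PreconnectedSpace TopCat.I :=
    TopCat.I.homeomorph.symm.surjective.denseRange.preconnectedSpace
      TopCat.I.homeomorph.symm.continuous
  have key : (fun t => e τ t - e τ 0) = fun t => e τ' t - e τ' 0 := by
    refine Circle.isCoveringMap_exp.eq_of_comp_eq ?_ ?_ ?_ 0 (by simp)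
    · exact (e τ).hom.continuous.sub continuous_const
    · exact (e τ').hom.continuous.sub continuous_const
    · ext t : 1
      simp only [Function.comp_apply, Circle.exp_sub, hexp]
  exact congrFun key 1

/-- The winding number (in radians) of one-chains of the circle. -/
lemma exists_winding :
    ∃ w : ChainsModBoundaries Circle →ₗ[ℤ] ℝ, ∀ x, w (arcClass x) = x := by
  choose lift hlift using exists_lift_simplex (n := 1)
  let D : Simplices ℝ 1 → ℝ := fun τ => (τ.face 0).point - (τ.face 1).point
  have hD (τ : Simplices ℝ 1) : D (lift (τ.map Circle.exp)) = D τ :=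
    displacement_eq_of_map_exp_eq (hlift _)
  obtain ⟨w, hw⟩ := exists_linearMap_of_cocycle (fun σ => D (lift σ)) fun σ => by
    obtain ⟨τ, rfl⟩ := exists_lift_simplex σ
    have h00 : (τ.face 1).face 0 = (τ.face 0).face 0 :=
      SSet.δ_comp_δ_apply (S := TopCat.toSSet.obj (TopCat.of ℝ)) (i := 0) (j := 0) le_rfl τ
    have h01 : (τ.face 2).face 0 = (τ.face 0).face 1 :=
      SSet.δ_comp_δ_apply (S := TopCat.toSSet.obj (TopCat.of ℝ)) (i := 0) (j := 1) zero_le_one τ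
    have h11 : (τ.face 2).face 1 = (τ.face 1).face 1 :=
      SSet.δ_comp_δ_apply (S := TopCat.toSSet.obj (TopCat.of ℝ)) (i := 1) (j := 1) le_rfl τ
    simp only [Simplices.face_map, hD]
    simp only [D, h00, h01, h11]
    ring
  refine ⟨w, fun x => ?_⟩
  rw [arcClass, segmentClass, chainsMap_simplexClass, hw, hD]
  simp [D]

/-- A one-cycle on the circle is homologous to a multiple of the full turn. -/
lemma mem_zmultiples_of_boundary_eq_zero {z : ChainsModBoundaries Circle}
    (hz : boundary Circle z = 0) : z ∈ AddSubgroup.zmultiples (arcClass (2 * Real.pi)) := by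
  set S := AddSubgroup.zmultiples (arcClass (2 * Real.pi))
  -- `s` joins every point of the circle to `1` by an arc.
  obtain ⟨s, hs⟩ := exists_linearMap_simplexChain (X := Circle) (n := 0)
    fun p => arcClass (Complex.arg p.point)
  have hmem (x : ℝ) : arcClass x - s (simplexChain (pointSimplex (Circle.exp x))) ∈ S := by
    obtain ⟨m, hm⟩ := Circle.exp_eq_exp.1 (Circle.exp_arg (Circle.exp x))
    rw [hs, point_pointSimplex, hm, arcClass_add_zsmul_two_pi, sub_add_cancel_right]
    exact S.neg_mem ⟨m, rfl⟩
  have key : QuotientAddGroup.mk' S =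
      (QuotientAddGroup.mk' S).comp (s.toAddMonoidHom.comp (boundary Circle).toAddMonoidHom) := by
    refine chainsModBoundaries_hom_ext fun σ => ?_
    obtain ⟨τ, rfl⟩ := exists_lift_simplex σ
    rw [← sub_eq_zero, AddMonoidHom.comp_apply, ← map_sub, QuotientAddGroup.mk'_apply,
      QuotientAddGroup.eq_zero_iff]
    change simplexClass _ - s (boundary Circle (simplexClass _)) ∈ S
    rw [boundary_simplexClass, map_sub, ← chainsMap_simplexClass, simplexClass_eq_segmentClass,
      chainsMap_segmentClass, sub_sub_sub_comm]
    have h0 := hmem (τ.face 0).point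
    have h1 := hmem (τ.face 1).point
    rw [← Simplices.point_map, pointSimplex_point, ← Simplices.face_map] at h0 h1
    exact S.sub_mem h0 h1
  have := DFunLike.congr_fun key z
  change QuotientAddGroup.mk' S z = QuotientAddGroup.mk' S (s (boundary Circle z)) at this
  rwa [hz, map_zero, map_zero, QuotientAddGroup.mk'_apply, QuotientAddGroup.eq_zero_iff] at this

lemma nonempty_addEquiv_H1_circle : Nonempty (ℤ ≃+ H1 Circle) := by
  obtain ⟨w, hw⟩ := exists_winding
  have hb : boundary Circle (arcClass (2 * Real.pi)) = 0 := by
    rw [arcClass, segmentClass, chainsMap_simplexClass, pathSimplex_map, boundary_simplexClass]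
    simp
  obtain ⟨x, hx⟩ := (exact_homologyInclusion_boundary _).1 hb
  refine ⟨AddEquiv.ofBijective (zmultiplesHom (H1 Circle) x) ⟨?_, fun y => ?_⟩⟩
  · rw [injective_iff_map_eq_zero]
    intro n hn
    have := congrArg (fun y => w (homologyInclusion Circle y)) hn
    simp only [zmultiplesHom_apply, map_zsmul, hx, hw, map_zero, zsmul_eq_mul,
      mul_eq_zero, Int.cast_eq_zero] at this
    simpa [Real.pi_ne_zero] using this
  · obtain ⟨n, hn⟩ := AddSubgroup.mem_zmultiples_iff.1 (mem_zmultiples_of_boundary_eq_zero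
      ((exact_homologyInclusion_boundary _).2 ⟨y, rfl⟩))
    refine ⟨n, homologyInclusion_injective ?_⟩
    rw [zmultiplesHom_apply, map_zsmul, hx, hn]

end Paths

/-- The module structure on `A` is the canonical one, so an additive equivalence suffices. -/
lemma rank_eq_one_of_addEquiv {A : Type} [AddCommGroup A] (e : ℤ ≃+ A) : Module.rank ℤ A = 1 := by
  rw [← e.toIntLinearEquiv.rank_eq, Module.rank_self]

/-! ### Maps to the circle -/

section Normalize

variable {X : Type} [TopologicalSpace X]

/-- The map to the circle obtained by normalising a nowhere vanishing complex function. -/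
def normalizeToCircle (N : C(X, ℂ)) (hN : ∀ x, N x ≠ 0) : C(X, Circle) where
  toFun x := ⟨N x / ‖N x‖, mem_sphere_zero_iff_norm.2 (by simp [hN x])⟩
  continuous_toFun := by
    refine Continuous.subtype_mk (N.continuous.div (by fun_prop) fun x => ?_) _
    simpa using hN x

lemma coe_normalizeToCircle (N : C(X, ℂ)) (hN : ∀ x, N x ≠ 0) (x : X) :
    (normalizeToCircle N hN x : ℂ) = N x / ‖N x‖ := rfl

lemma homotopic_normalizeToCircle {N₀ N₁ : C(X, ℂ)} (h₀ : ∀ x, N₀ x ≠ 0) (h₁ : ∀ x, N₁ x ≠ 0)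
    (h : ∀ x, ∀ t ∈ Ioo (0 : ℝ) 1, (1 - t) * N₀ x + t * N₁ x ≠ 0) :
    (normalizeToCircle N₀ h₀).Homotopic (normalizeToCircle N₁ h₁) := by
  have hne : ∀ p : unitInterval × X,
      (1 - ((p.1 : ℝ) : ℂ)) * N₀ p.2 + ((p.1 : ℝ) : ℂ) * N₁ p.2 ≠ 0 := by
    rintro ⟨⟨t, ht0, ht1⟩, x⟩
    rcases ht0.eq_or_lt with rfl | ht0
    · simpa using h₀ x
    rcases ht1.eq_or_lt with rfl | ht1
    · simpa using h₁ x
    exact h x t ⟨ht0, ht1⟩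
  refine ⟨⟨normalizeToCircle ⟨fun p => (1 - ((p.1 : ℝ) : ℂ)) * N₀ p.2 + ((p.1 : ℝ) : ℂ) * N₁ p.2,
    by fun_prop⟩ hne, fun x => ?_, fun x => ?_⟩⟩ <;>
  · ext1
    simp [coe_normalizeToCircle]

end Normalize

/-! ### The configuration space of the letter Y -/

section LetterY

lemma mem_letterY_iff {x : Fin 3 → ℝ} :
    x ∈ letterY ↔ (∀ i, x i ∈ Icc (0 : ℝ) 1) ∧ ∀ i j, i ≠ j → x i = 0 ∨ x j = 0 := by
  constructor
  · rintro ⟨i, t, ht, rfl⟩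
    refine ⟨fun j => ?_, fun j k hjk => ?_⟩
    · rcases eq_or_ne j i with rfl | h
      · simpa using ht
      · simp [h]
    · rcases eq_or_ne j i with rfl | h
      · exact Or.inr (by simp [hjk.symm])
      · exact Or.inl (by simp [h])
  · rintro ⟨h1, h2⟩
    by_cases h : ∃ i, x i ≠ 0
    · obtain ⟨i, hi⟩ := h
      refine ⟨i, x i, h1 i, ?_⟩
      ext j
      rcases eq_or_ne j i with rfl | h
      · simp
      · simpa [h] using (h2 j i h).resolve_right hi
    · push Not at h
      exact ⟨0, 0, by simp, by ext j; simp [h j]⟩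

variable {Z : Type} [TopologicalSpace Z]

lemma injective_pair_of_ne {X : Type} {x y : X} (h : x ≠ y) : Function.Injective ![x, y] := by
  intro i j
  fin_cases i <;> fin_cases j <;> simp [h, h.symm]

/-- A pair of maps to a space that differ everywhere, as a map to the configuration space. -/
def Conf.pair {X : Type} [TopologicalSpace X] (x y : C(Z, X)) (hxy : ∀ z, x z ≠ y z) :
    C(Z, Conf 2 X) where
  toFun z := ⟨![x z, y z], injective_pair_of_ne (hxy z)⟩
  continuous_toFun := Continuous.subtype_mk (continuous_pi fun i => by
    fin_cases i
    · exact x.continuous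
    · exact y.continuous) _

/-- A pair of maps to `ℝ ^ 3` with image in the letter Y that differ everywhere, as a map to the
configuration space of the letter Y. -/
def Conf.pairY (x y : C(Z, Fin 3 → ℝ)) (hx : ∀ z, x z ∈ letterY) (hy : ∀ z, y z ∈ letterY)
    (hxy : ∀ z, x z ≠ y z) : C(Z, Conf 2 letterY) :=
  Conf.pair ⟨fun z => ⟨x z, hx z⟩, by fun_prop⟩ ⟨fun z => ⟨y z, hy z⟩, by fun_prop⟩
    fun z h => hxy z (congrArg Subtype.val h)

lemma Conf.ext_letterY {c d : Conf 2 letterY} (h0 : (c.1 0 : Fin 3 → ℝ) = d.1 0)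
    (h1 : (c.1 1 : Fin 3 → ℝ) = d.1 1) : c = d := by
  apply Subtype.ext
  funext i
  apply Subtype.ext
  fin_cases i
  · exact h0
  · exact h1

lemma Conf.ne_letterY (c : Conf 2 letterY) : (c.1 0 : Fin 3 → ℝ) ≠ c.1 1 := fun h =>
  absurd (c.2 (Subtype.ext h)) (by decide)

/-- The excess of each coordinate over the maximum of the other two, if it is positive. -/
def excess (p : Fin 3 → ℝ) : Fin 3 → ℝ :=
  ![max 0 (p 0 - max (p 1) (p 2)), max 0 (p 1 - max (p 0) (p 2)), max 0 (p 2 - max (p 0) (p 1))]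

lemma continuous_excess : Continuous excess := by
  unfold excess
  fun_prop

lemma excess_mul {c : ℝ} (hc : 0 ≤ c) (p : Fin 3 → ℝ) : excess (c • p) = c • excess p := by
  ext i
  fin_cases i <;>
    simp [excess, mul_max_of_nonneg _ _ hc, mul_sub]

lemma excess_add_const (p : Fin 3 → ℝ) (c : ℝ) : excess (fun i => p i + c) = excess p := by
  ext i
  fin_cases i <;> simp [excess, max_add_add_right]

lemma excess_mem_letterY {p : Fin 3 → ℝ} (h : ∀ i j, p i - p j ≤ 1) : excess p ∈ letterY := by
  rw [mem_letterY_iff]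
  refine ⟨fun i => ?_, fun i j hij => ?_⟩
  · fin_cases i <;> simp [excess]
    · linarith [h 0 1, le_max_left (p 1) (p 2)]
    · linarith [h 1 0, le_max_left (p 0) (p 2)]
    · linarith [h 2 0, le_max_left (p 0) (p 1)]
  · fin_cases i <;> fin_cases j <;> simp [excess] at hij ⊢ <;> grind

/-- The difference of the excess of `p` and of `-p` is `p` up to an additive constant, the median
of `p`. -/
lemma excess_sub_excess_neg (p : Fin 3 → ℝ) (i j : Fin 3) :
    (excess p i - excess (-p) i) - (excess p j - excess (-p) j) = p i - p j := by
  fin_cases i <;> fin_cases j <;> simp [excess] <;> grind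

lemma excess_sub_of_mem_letterY {x y : Fin 3 → ℝ} (hx : x ∈ letterY) (hy : y ∈ letterY) :
    excess (x - y) = x - x ⊓ y := by
  obtain ⟨i, s, ⟨hs, -⟩, rfl⟩ := hx
  obtain ⟨j, t, ⟨ht, -⟩, rfl⟩ := hy
  ext k
  fin_cases i <;> fin_cases j <;> fin_cases k <;> simp [excess, hs, ht] <;> grind

end LetterY

section ConfY

/-- The projection of `ℝ ^ 3` along the diagonal to the plane, which is identified with `ℂ`. -/
def planar (d : Fin 3 → ℝ) : ℂ := ⟨d 0 - d 1, d 1 - d 2⟩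

lemma continuous_planar : Continuous planar := by
  have : planar = fun d : Fin 3 → ℝ =>
      ((d 0 - d 1 : ℝ) : ℂ) + ((d 1 - d 2 : ℝ) : ℂ) * Complex.I := by
    ext d
    apply Complex.ext <;> simp [planar]
  rw [this]
  fun_prop

/-- A section of `planar`. -/
def planarSection (z : ℂ) : Fin 3 → ℝ := ![z.re, 0, -z.im]

lemma continuous_planarSection : Continuous planarSection := by
  unfold planarSection
  fun_prop

lemma planar_excess_sub (p : Fin 3 → ℝ) : planar (excess p - excess (-p)) = planar p := by
  apply Complex.ext
  · exact excess_sub_excess_neg p 0 1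
  · exact excess_sub_excess_neg p 1 2

lemma planar_planarSection (z : ℂ) : planar (planarSection z) = z := by
  apply Complex.ext <;> simp [planar, planarSection]

lemma excess_planarSection_planar (d : Fin 3 → ℝ) :
    excess (planarSection (planar d)) = excess d := by
  rw [← excess_add_const d (-d 1)]
  congr 1
  ext i
  fin_cases i <;> simp [planar, planarSection] <;> ring

lemma planarSection_neg (z : ℂ) : planarSection (-z) = -planarSection z := by
  ext i
  fin_cases i <;> simp [planarSection]

lemma planarSection_smul (c : ℝ) (z : ℂ) : planarSection (c * z) = c • planarSection z := by
  ext i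
  fin_cases i <;> simp [planarSection]

lemma planar_sub_ne_zero {x y : Fin 3 → ℝ} (hx : x ∈ letterY) (hy : y ∈ letterY) (h : x ≠ y) :
    planar (x - y) ≠ 0 := by
  intro h0
  have e1 : excess (x - y) = 0 := by
    rw [← excess_planarSection_planar, h0]
    ext i
    fin_cases i <;> simp [planarSection, excess]
  have e2 : excess (y - x) = 0 := by
    rw [← excess_planarSection_planar, ← neg_sub x y,
      show planar (-(x - y)) = -planar (x - y) from by
      apply Complex.ext <;> simp [planar] <;> ring, h0]
    ext i
    fin_cases i <;> simp [planarSection, excess]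
  rw [excess_sub_of_mem_letterY hx hy, sub_eq_zero, left_eq_inf] at e1
  rw [excess_sub_of_mem_letterY hy hx, sub_eq_zero, left_eq_inf] at e2
  exact h (le_antisymm e1 e2)

variable {ε : ℝ}

lemma excess_planarSection_mem_letterY (hε : ε ∈ Ioc (0 : ℝ) (1 / 2)) {z : ℂ} (hz : ‖z‖ = 1) :
    ε • excess (planarSection z) ∈ letterY := by
  have hr := abs_le.1 ((Complex.abs_re_le_norm z).trans_eq hz)
  have hi := abs_le.1 ((Complex.abs_im_le_norm z).trans_eq hz)
  rw [← excess_mul hε.1.le]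
  refine excess_mem_letterY fun i j => ?_
  have : planarSection z i - planarSection z j ≤ 2 := by
    fin_cases i <;> fin_cases j <;> simp [planarSection] <;> linarith
  calc (ε • planarSection z) i - (ε • planarSection z) j
      = ε * (planarSection z i - planarSection z j) := by simp [mul_sub]
    _ ≤ 1 / 2 * 2 := by
      rcases le_total 0 (planarSection z i - planarSection z j) with h | h
      · exact mul_le_mul hε.2 this h (by norm_num)
      · nlinarith [hε.1]
    _ = 1 := by norm_num

lemma planar_smul_excess_sub (c : ℝ) (z : ℂ) :
    planar (c • excess (planarSection z) - c • excess (planarSection (-z))) = c * z := by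
  have h := planar_excess_sub (planarSection z)
  rw [planar_planarSection, ← planarSection_neg] at h
  rw [← smul_sub, ← congrArg (fun w => (c : ℂ) * w) h]
  apply Complex.ext <;> simp [planar] <;> ring

/-- The loop in the configuration space of the letter Y, at scale `ε`, along which two particles
exchange their positions twice. -/
def exchangeLoop (hε : ε ∈ Ioc (0 : ℝ) (1 / 2)) : C(Circle, Conf 2 letterY) :=
  Conf.pairY
    ⟨fun z => ε • excess (planarSection z),
      (continuous_excess.comp (continuous_planarSection.comp continuous_subtype_val)).const_smul ε⟩
    ⟨fun z => ε • excess (planarSection (-z)),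
      (continuous_excess.comp
        (continuous_planarSection.comp continuous_subtype_val.neg)).const_smul ε⟩
    (fun z => excess_planarSection_mem_letterY hε z.norm_coe)
    (fun z => excess_planarSection_mem_letterY hε (by rw [norm_neg, z.norm_coe]))
    fun z h => by
      have := planar_smul_excess_sub ε z
      change ε • excess (planarSection z) = ε • excess (planarSection (-z)) at h
      rw [h, sub_self] at this
      have h0 : planar 0 = 0 := by apply Complex.ext <;> simp [planar]
      exact mul_ne_zero (Complex.ofReal_ne_zero.2 hε.1.ne') z.coe_ne_zero (this.symm.trans h0)

/-- The first coordinate of a configuration in the letter Y. -/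
def Conf.fstY : C(Conf 2 letterY, Fin 3 → ℝ) :=
  ⟨fun c => (c.1 0 : Fin 3 → ℝ),
    continuous_subtype_val.comp ((continuous_apply 0).comp continuous_subtype_val)⟩

/-- The second coordinate of a configuration in the letter Y. -/
def Conf.sndY : C(Conf 2 letterY, Fin 3 → ℝ) :=
  ⟨fun c => (c.1 1 : Fin 3 → ℝ),
    continuous_subtype_val.comp ((continuous_apply 1).comp continuous_subtype_val)⟩

lemma Conf.fstY_mem (c : Conf 2 letterY) : Conf.fstY c ∈ letterY := (c.1 0).2

lemma Conf.sndY_mem (c : Conf 2 letterY) : Conf.sndY c ∈ letterY := (c.1 1).2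

lemma Conf.continuous_inf_letterY :
    Continuous fun c : Conf 2 letterY => Conf.fstY c ⊓ Conf.sndY c :=
  continuous_pi fun i => ((continuous_apply i).comp Conf.fstY.continuous).inf
    ((continuous_apply i).comp Conf.sndY.continuous)

/-- The planar difference of the two particles, as a nowhere vanishing function. -/
def planarDifference : C(Conf 2 letterY, ℂ) :=
  ⟨fun c => planar (Conf.fstY c - Conf.sndY c), continuous_planar.comp (by fun_prop)⟩

lemma planarDifference_ne_zero (c : Conf 2 letterY) : planarDifference c ≠ 0 :=
  planar_sub_ne_zero (c.1 0).2 (c.1 1).2 (Conf.ne_letterY c)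

/-- The direction of the planar difference of two particles in the letter Y. -/
def confYDirection : C(Conf 2 letterY, Circle) :=
  normalizeToCircle planarDifference planarDifference_ne_zero

lemma confYDirection_exchangeLoop (hε : ε ∈ Ioc (0 : ℝ) (1 / 2)) (z : Circle) :
    confYDirection (exchangeLoop hε z) = z := by
  have h : planarDifference (exchangeLoop hε z) = ε * z := planar_smul_excess_sub ε z
  ext1
  rw [confYDirection, coe_normalizeToCircle, h]
  have : (ε : ℂ) ≠ 0 := Complex.ofReal_ne_zero.2 hε.1.ne'
  rw [norm_mul, z.norm_coe, Complex.norm_real, Real.norm_of_nonneg hε.1.le, mul_one,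
    mul_div_cancel_left₀ _ this]

lemma mem_letterY_sub_smul_inf {x y : Fin 3 → ℝ} (hx : x ∈ letterY) (hy : y ∈ letterY) {t : ℝ}
    (ht : t ∈ Icc (0 : ℝ) 1) : x - t • (x ⊓ y) ∈ letterY := by
  rw [mem_letterY_iff] at *
  refine ⟨fun i => ?_, fun i j hij => ?_⟩
  · have h0 : 0 ≤ (x ⊓ y) i := le_inf (hx.1 i).1 (hy.1 i).1
    have h1 : (x ⊓ y) i ≤ x i := inf_le_left
    have := (hx.1 i).2
    simp only [Pi.sub_apply, Pi.smul_apply, smul_eq_mul]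
    constructor <;> nlinarith [ht.1, ht.2]
  · refine (hx.2 i j hij).imp (fun h => ?_) (fun h => ?_) <;> simp [h, (hy.1 _).1]

/-- If both particles are on the same arm, slide them towards the centre, keeping their distance,
until one of them gets there. -/
def slideToCentre : C(Conf 2 letterY, Conf 2 letterY) :=
  Conf.pairY ⟨fun c => Conf.fstY c - Conf.fstY c ⊓ Conf.sndY c,
      Conf.fstY.continuous.sub Conf.continuous_inf_letterY⟩
    ⟨fun c => Conf.sndY c - Conf.fstY c ⊓ Conf.sndY c,
      Conf.sndY.continuous.sub Conf.continuous_inf_letterY⟩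
    (fun c => by
      have := mem_letterY_sub_smul_inf (Conf.fstY_mem c) (Conf.sndY_mem c) (t := 1) (by simp)
      rwa [one_smul] at this)
    (fun c => by
      have := mem_letterY_sub_smul_inf (Conf.sndY_mem c) (Conf.fstY_mem c) (t := 1) (by simp)
      rwa [one_smul, inf_comm] at this)
    fun c h => Conf.ne_letterY c (sub_left_injective h)

lemma id_homotopic_slideToCentre :
    (ContinuousMap.id (Conf 2 letterY)).Homotopic slideToCentre := by
  refine ⟨⟨Conf.pairY (Z := unitInterval × Conf 2 letterY)
    ⟨fun p => Conf.fstY p.2 - (p.1 : ℝ) • (Conf.fstY p.2 ⊓ Conf.sndY p.2),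
      (Conf.fstY.continuous.comp continuous_snd).sub
        ((continuous_subtype_val.comp continuous_fst).smul
        (Conf.continuous_inf_letterY.comp continuous_snd))⟩
    ⟨fun p => Conf.sndY p.2 - (p.1 : ℝ) • (Conf.fstY p.2 ⊓ Conf.sndY p.2),
      (Conf.sndY.continuous.comp continuous_snd).sub
        ((continuous_subtype_val.comp continuous_fst).smul
        (Conf.continuous_inf_letterY.comp continuous_snd))⟩
    (fun p => mem_letterY_sub_smul_inf (p.2.1 0).2 (p.2.1 1).2 p.1.2)
    (fun p => by
      have := mem_letterY_sub_smul_inf (Conf.sndY_mem p.2) (Conf.fstY_mem p.2) p.1.2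
      rwa [inf_comm] at this)
    fun p h => Conf.ne_letterY p.2 (sub_left_injective h), fun c => ?_, fun c => ?_⟩⟩
  · apply Conf.ext_letterY
    · change Conf.fstY c - (0 : ℝ) • _ = _
      rw [zero_smul, sub_zero]
      rfl
    · change Conf.sndY c - (0 : ℝ) • _ = _
      rw [zero_smul, sub_zero]
      rfl
  · apply Conf.ext_letterY
    · change Conf.fstY c - (1 : ℝ) • _ = _
      rw [one_smul]
      rfl
    · change Conf.sndY c - (1 : ℝ) • _ = _
      rw [one_smul]
      rfl

lemma exchangeLoop_confYDirection (hε : ε ∈ Ioc (0 : ℝ) (1 / 2)) (c : Conf 2 letterY) :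
    (Conf.fstY (exchangeLoop hε (confYDirection c)) =
      (ε / ‖planarDifference c‖) • Conf.fstY (slideToCentre c)) ∧
    (Conf.sndY (exchangeLoop hε (confYDirection c)) =
      (ε / ‖planarDifference c‖) • Conf.sndY (slideToCentre c)) := by
  have hdir : (confYDirection c : ℂ) = (‖planarDifference c‖⁻¹ : ℝ) * planarDifference c := by
    rw [confYDirection, coe_normalizeToCircle]
    push_cast
    ring
  have hpos : 0 ≤ ‖planarDifference c‖⁻¹ := by positivity
  constructor
  · change ε • excess (planarSection (confYDirection c)) =
      (ε / _) • (Conf.fstY c - Conf.fstY c ⊓ Conf.sndY c)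
    rw [hdir, planarSection_smul, excess_mul hpos, smul_smul, div_eq_mul_inv]
    change _ • excess (planarSection (planar _)) = _
    rw [excess_planarSection_planar]
    exact congrArg _ (excess_sub_of_mem_letterY (c.1 0).2 (c.1 1).2)
  · change ε • excess (planarSection (-confYDirection c)) =
      (ε / _) • (Conf.sndY c - Conf.fstY c ⊓ Conf.sndY c)
    have hneg : -planarDifference c = planar (Conf.sndY c - Conf.fstY c) := by
      apply Complex.ext <;> simp [planar, planarDifference] <;> ring
    rw [hdir, ← mul_neg, planarSection_smul, excess_mul hpos, smul_smul, div_eq_mul_inv, hneg,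
      excess_planarSection_planar, inf_comm]
    exact congrArg _ (excess_sub_of_mem_letterY (c.1 1).2 (c.1 0).2)

/-- Configurations with a particle at the centre, or with particles on different arms, are rescaled
to a fixed size. -/
lemma slideToCentre_homotopic (hε : ε ∈ Ioc (0 : ℝ) (1 / 2)) :
    slideToCentre.Homotopic ((exchangeLoop hε).comp confYDirection) := by
  let k : C(Conf 2 letterY, ℝ) := ⟨fun c => ε / ‖planarDifference c‖,
    continuous_const.div (by fun_prop) fun c => norm_ne_zero_iff.2 (planarDifference_ne_zero c)⟩
  have hk (c) : 0 < k c := div_pos hε.1 (norm_pos_iff.2 (planarDifference_ne_zero c))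
  let s : C(unitInterval × Conf 2 letterY, ℝ) := ⟨fun p => (1 - (p.1 : ℝ)) + p.1 * k p.2,
    by fun_prop⟩
  have hs (p) : 0 < s p := by
    have h0 := p.1.2.1
    have h1 := p.1.2.2
    rcases h0.eq_or_lt with h | h
    · simp [s, ← h]
    · exact add_pos_of_nonneg_of_pos (by linarith) (mul_pos h (hk p.2))
  -- A convex combination of two points of one arm is on that arm.
  have hmem {x : Fin 3 → ℝ} (p) (hx : x ∈ letterY) (hkx : k p.2 • x ∈ letterY) :
      s p • x ∈ letterY := by
    rw [mem_letterY_iff] at *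
    refine ⟨fun i => ?_, fun i j hij => (hx.2 i j hij).imp (by simp +contextual)
      (by simp +contextual)⟩
    have := hx.1 i
    have := hkx.1 i
    have : (s p • x) i = (1 - (p.1 : ℝ)) • x i + (p.1 : ℝ) • (k p.2 • x) i := by
      simp [s]
      ring
    rw [this]
    exact convex_Icc (0 : ℝ) 1 (hx.1 i) (hkx.1 i) (by linarith [p.1.2.2]) p.1.2.1 (by ring)
  have h1 (c) := exchangeLoop_confYDirection hε c
  refine ⟨⟨Conf.pairY (Z := unitInterval × Conf 2 letterY)
    ⟨fun p => s p • Conf.fstY (slideToCentre p.2), by fun_prop⟩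
    ⟨fun p => s p • Conf.sndY (slideToCentre p.2), by fun_prop⟩
    (fun p => hmem p ((slideToCentre p.2).1 0).2 ?_)
    (fun p => hmem p ((slideToCentre p.2).1 1).2 ?_)
    fun p h => Conf.ne_letterY _ (smul_right_injective _ (hs p).ne' h), fun c => ?_, fun c => ?_⟩⟩
  · exact (h1 p.2).1 ▸ ((exchangeLoop hε (confYDirection p.2)).1 0).2
  · exact (h1 p.2).2 ▸ ((exchangeLoop hε (confYDirection p.2)).1 1).2
  · have : s (0, c) = 1 := by simp [s]
    apply Conf.ext_letterY
    · change s (0, c) • Conf.fstY (slideToCentre c) = _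
      rw [this, one_smul]
      rfl
    · change s (0, c) • Conf.sndY (slideToCentre c) = _
      rw [this, one_smul]
      rfl
  · have : s (1, c) = ε / ‖planarDifference c‖ := by simp [s, k]
    apply Conf.ext_letterY
    · change s (1, c) • Conf.fstY (slideToCentre c) = _
      rw [this]
      exact (h1 c).1.symm
    · change s (1, c) • Conf.sndY (slideToCentre c) = _
      rw [this]
      exact (h1 c).2.symm

/-- The configuration space of the letter Y is homotopy equivalent to the circle. -/
def circleHomotopyEquivConfY (hε : ε ∈ Ioc (0 : ℝ) (1 / 2)) :
    ContinuousMap.HomotopyEquiv Circle (Conf 2 letterY) where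
  toFun := exchangeLoop hε
  invFun := confYDirection
  left_inv := by
    rw [show confYDirection.comp (exchangeLoop hε) = ContinuousMap.id _ from
      ContinuousMap.ext (confYDirection_exchangeLoop hε)]
  right_inv := (id_homotopic_slideToCentre.trans (slideToCentre_homotopic hε)).symm

end ConfY

/-! ### Edges of a graph -/

section Edges

open RelCWComplex

variable {G : Type} [TopologicalSpace G] [CWComplex (univ : Set G)]

/-- The characteristic map of an edge, as a path parametrised by `[-1, 1]`. -/
def edge (e : cell (univ : Set G) 1) (t : ℝ) : G := map 1 e fun _ => t

lemma norm_const_fin_one (t : ℝ) : ‖(fun _ => t : Fin 1 → ℝ)‖ = |t| := by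
  rw [pi_norm_const, Real.norm_eq_abs]

lemma exists_eq_const_fin_one (x : Fin 1 → ℝ) : ∃ t : ℝ, x = fun _ => t :=
  ⟨x 0, by ext i; rw [Subsingleton.elim i 0]⟩

lemma continuousOn_edge (e : cell (univ : Set G) 1) : ContinuousOn (edge e) (Icc (-1) 1) := by
  refine (continuousOn 1 e).comp (by fun_prop) fun t ht => ?_
  rw [mem_closedBall_zero_iff, norm_const_fin_one]
  exact abs_le.2 ht

lemma openCell_eq_image_edge (e : cell (univ : Set G) 1) :
    openCell 1 e = edge e '' Ioo (-1) 1 := by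
  ext x
  constructor
  · rintro ⟨y, hy, rfl⟩
    obtain ⟨t, rfl⟩ := exists_eq_const_fin_one y
    rw [mem_ball_zero_iff, norm_const_fin_one] at hy
    exact ⟨t, abs_lt.1 hy, rfl⟩
  · rintro ⟨t, ht, rfl⟩
    exact ⟨_, by rw [mem_ball_zero_iff, norm_const_fin_one]; exact abs_lt.2 ht, rfl⟩

lemma closedCell_eq_image_edge (e : cell (univ : Set G) 1) :
    closedCell 1 e = edge e '' Icc (-1) 1 := by
  ext x
  constructor
  · rintro ⟨y, hy, rfl⟩
    obtain ⟨t, rfl⟩ := exists_eq_const_fin_one y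
    rw [mem_closedBall_zero_iff, norm_const_fin_one] at hy
    exact ⟨t, abs_le.1 hy, rfl⟩
  · rintro ⟨t, ht, rfl⟩
    exact ⟨_, by rw [mem_closedBall_zero_iff, norm_const_fin_one]; exact abs_le.2 ht, rfl⟩

lemma cellFrontier_eq_pair (e : cell (univ : Set G) 1) :
    cellFrontier 1 e = {edge e (-1), edge e 1} := by
  ext x
  constructor
  · rintro ⟨y, hy, rfl⟩
    obtain ⟨t, rfl⟩ := exists_eq_const_fin_one y
    rw [mem_sphere_zero_iff_norm, norm_const_fin_one] at hy
    rcases eq_or_eq_neg_of_abs_eq hy with rfl | rfl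
    · exact Or.inr rfl
    · exact Or.inl rfl
  · rintro (rfl | rfl)
    · exact ⟨fun _ => -1, by rw [mem_sphere_zero_iff_norm, norm_const_fin_one]; simp, rfl⟩
    · exact ⟨fun _ => 1, by rw [mem_sphere_zero_iff_norm, norm_const_fin_one]; simp, rfl⟩

lemma edge_injective {e e' : cell (univ : Set G) 1} {t t' : ℝ} (ht : t ∈ Ioo (-1 : ℝ) 1)
    (ht' : t' ∈ Ioo (-1 : ℝ) 1) (h : edge e t = edge e' t') : e = e' ∧ t = t' := by
  have he : e = e' := by
    by_contra hne
    have hd := disjoint_openCell_of_ne (C := (univ : Set G)) (n := 1) (m := 1) (i := e) (j := e')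
      (by simpa using hne)
    rw [openCell_eq_image_edge, openCell_eq_image_edge] at hd
    exact hd.ne_of_mem ⟨t, ht, rfl⟩ ⟨t', ht', rfl⟩ h
  subst he
  refine ⟨rfl, ?_⟩
  have hs {t : ℝ} (ht : t ∈ Ioo (-1 : ℝ) 1) : (fun _ => t : Fin 1 → ℝ) ∈ (map 1 e).source := by
    rw [source_eq, mem_ball_zero_iff, norm_const_fin_one]
    exact abs_lt.2 ht
  exact congrFun ((map 1 e).injOn (hs ht) (hs ht') h) 0

lemma openCell_zero_eq_closedCell (x : cell (univ : Set G) 0) : openCell 0 x = closedCell 0 x := by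
  rw [openCell, closedCell]
  congr 1
  ext y
  simp [Subsingleton.elim y 0]

lemma edge_notMem_vertexSet {e : cell (univ : Set G) 1} {t : ℝ} (ht : t ∈ Ioo (-1 : ℝ) 1) :
    edge e t ∉ vertexSet G := by
  intro h
  obtain ⟨x, hx⟩ := mem_iUnion.1 h
  rw [← openCell_zero_eq_closedCell] at hx
  have hd := disjoint_openCell_of_ne (C := (univ : Set G)) (n := 1) (m := 0) (i := e) (j := x)
    (by simp)
  rw [openCell_eq_image_edge] at hd
  exact hd.ne_of_mem ⟨t, ht, rfl⟩ hx rfl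

lemma cellFrontier_subset_vertexSet (e : cell (univ : Set G) 1) :
    cellFrontier 1 e ⊆ vertexSet G := by
  obtain ⟨I, hI⟩ := CWComplex.cellFrontier_subset_finite_closedCell 1 e
  refine hI.trans fun x hx => ?_
  simp only [mem_iUnion] at hx
  obtain ⟨m, hm, j, -, hj⟩ := hx
  obtain rfl : m = 0 := by omega
  exact mem_iUnion.2 ⟨j, hj⟩

lemma edge_one_mem_vertexSet (e : cell (univ : Set G) 1) : edge e 1 ∈ vertexSet G :=
  cellFrontier_subset_vertexSet e (by simp [cellFrontier_eq_pair])

lemma edge_neg_one_mem_vertexSet (e : cell (univ : Set G) 1) : edge e (-1) ∈ vertexSet G :=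
  cellFrontier_subset_vertexSet e (by simp [cellFrontier_eq_pair])

lemma IsFiniteGraph.mem_vertexSet_or (hG : IsFiniteGraph G) (x : G) :
    x ∈ vertexSet G ∨ ∃ e, ∃ t ∈ Ioo (-1 : ℝ) 1, x = edge e t := by
  have hx : x ∈ ⋃ (n : ℕ) (j : cell (univ : Set G) n), closedCell n j := by
    rw [CWComplex.union]
    trivial
  simp only [mem_iUnion] at hx
  obtain ⟨n, j, hj⟩ := hx
  obtain rfl | rfl | hn : n = 0 ∨ n = 1 ∨ 2 ≤ n := by omega
  · exact Or.inl (mem_iUnion.2 ⟨j, hj⟩)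
  · rw [closedCell_eq_image_edge] at hj
    obtain ⟨t, ht, rfl⟩ := hj
    rcases ht.1.eq_or_lt with rfl | h1
    · exact Or.inl (edge_neg_one_mem_vertexSet j)
    rcases ht.2.eq_or_lt with rfl | h2
    · exact Or.inl (edge_one_mem_vertexSet j)
    exact Or.inr ⟨j, t, ⟨h1, h2⟩, rfl⟩
  · exact ((hG.dim_le_one n hn).false j).elim

lemma IsFiniteGraph.finite_cell (hG : IsFiniteGraph G) (n : ℕ) :
    Finite (cell (univ : Set G) n) :=
  have := hG.finite
  RelCWComplex.FiniteType.finite_cell (C := (univ : Set G)) n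

lemma IsFiniteGraph.finite_vertexSet (hG : IsFiniteGraph G) : (vertexSet G).Finite := by
  have := hG.finite_cell 0
  refine Set.finite_iUnion fun x => ?_
  rw [RelCWComplex.closedCell_zero_eq_singleton]
  exact finite_singleton _

lemma IsFiniteGraph.compactSpace (hG : IsFiniteGraph G) : CompactSpace G := by
  have := hG.finite_cell 1
  refine ⟨?_⟩
  have : (univ : Set G) = vertexSet G ∪ ⋃ e : cell (univ : Set G) 1, closedCell 1 e := by
    refine (eq_univ_of_forall fun x => ?_).symm
    rcases hG.mem_vertexSet_or x with h | ⟨e, t, ht, rfl⟩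
    · exact Or.inl h
    · refine Or.inr (mem_iUnion.2 ⟨e, ?_⟩)
      rw [closedCell_eq_image_edge]
      exact ⟨t, Ioo_subset_Icc_self ht, rfl⟩
  rw [this]
  exact hG.finite_vertexSet.isCompact.union (isCompact_iUnion fun e => isCompact_closedCell)

end Edges

/-! ### Stars -/

/-- `P` is a finite family of paths issuing from `v`, injective and disjoint in their interior,
which ends in a finite set `V` of points and covers everything except for `V` and a closed set `E`
that avoids `v`. -/
structure IsStar {X : Type} [TopologicalSpace X] (v : X) {H : Type} (P : H → ℝ → X)
    (V E : Set X) : Prop where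
  finite : Finite H
  finite_vertices : V.Finite
  isClosed_rest : IsClosed E
  continuousOn : ∀ h, ContinuousOn (P h) (Icc 0 1)
  zero : ∀ h, P h 0 = v
  one_mem : ∀ h, P h 1 ∈ V
  one_ne : ∀ h, P h 1 ≠ v
  notMem_vertices : ∀ h, ∀ s ∈ Ioo (0 : ℝ) 1, P h s ∉ V
  notMem_rest : ∀ h, ∀ s ∈ Ioo (0 : ℝ) 1, P h s ∉ E
  injective : ∀ h h', ∀ s ∈ Ioo (0 : ℝ) 1, ∀ s' ∈ Ioo (0 : ℝ) 1, P h s = P h' s' → h = h' ∧ s = s'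
  center_mem : v ∈ V
  center_notMem : v ∉ E
  cover : ∀ x, x ∈ V ∨ x ∈ E ∨ ∃ h, ∃ s ∈ Ioo (0 : ℝ) 1, x = P h s

section GraphStar

open RelCWComplex

variable {G : Type} [TopologicalSpace G] [CWComplex (univ : Set G)]

/-- The sign `1` or `-1` of an end of an edge. -/
def endSign (b : Bool) : ℝ := if b then 1 else -1

/-- The half-edges at `v`, that is, the ends of edges that are attached at `v`. -/
def HalfEdge (v : G) : Type := {p : cell (univ : Set G) 1 × Bool // edge p.1 (endSign p.2) = v}

open Classical in
/-- The length of the part of an edge that belongs to a half-edge: a loop is cut in the middle. -/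
def HalfEdge.length {v : G} (h : HalfEdge v) : ℝ :=
  if edge h.1.1 (-endSign h.1.2) = v then 1 else 2

/-- The parametrisation of a half-edge by `[0, 1]`, starting at `v`. -/
def HalfEdge.path {v : G} (h : HalfEdge v) (s : ℝ) : G :=
  edge h.1.1 (endSign h.1.2 * (1 - h.length * s))

lemma endSign_cases (b : Bool) : endSign b = 1 ∨ endSign b = -1 := by
  cases b <;> simp [endSign]

lemma HalfEdge.param_mem {v : G} (h : HalfEdge v) {s : ℝ} (hs : s ∈ Ioo (0 : ℝ) 1) :
    endSign h.1.2 * (1 - h.length * s) ∈ Ioo (-1 : ℝ) 1 := by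
  obtain ⟨h0, h1⟩ := hs
  rcases endSign_cases h.1.2 with hb | hb <;> rw [hb] <;> unfold HalfEdge.length <;> split_ifs <;>
    constructor <;> linarith

lemma mem_nonincidentEdges_iff {v x : G} : x ∈ nonincidentEdges v ↔
    ∃ e, (edge e (-1) ≠ v ∧ edge e 1 ≠ v) ∧ x ∈ edge e '' Icc (-1) 1 := by
  simp only [nonincidentEdges, mem_iUnion, cellFrontier_eq_pair, closedCell_eq_image_edge,
    mem_insert_iff, mem_singleton_iff, not_or, exists_prop, eq_comm (a := v)]

lemma mem_loopMidpoints_iff {v x : G} : x ∈ loopMidpoints v ↔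
    ∃ e, (edge e (-1) = v ∧ edge e 1 = v) ∧ x = edge e 0 := by
  have hz (e : cell (univ : Set G) 1) : map 1 e 0 = edge e 0 := rfl
  have hp (a b : G) : ({a, b} : Set G) = {v} ↔ a = v ∧ b = v := by
    constructor
    · intro h
      have ha : a ∈ ({v} : Set G) := h ▸ mem_insert a {b}
      have hb : b ∈ ({v} : Set G) := h ▸ mem_insert_of_mem a rfl
      exact ⟨ha, hb⟩
    · rintro ⟨rfl, rfl⟩
      simp
  simp only [loopMidpoints, cellFrontier_eq_pair, mem_ofPred_eq, hz, hp]

lemma edge_interior_mem_nonincidentEdges {v : G} {e : cell (univ : Set G) 1} {t : ℝ}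
    (ht : t ∈ Ioo (-1 : ℝ) 1) (h : edge e t ∈ nonincidentEdges v) :
    edge e (-1) ≠ v ∧ edge e 1 ≠ v := by
  obtain ⟨e', he', t', ht', h⟩ := mem_nonincidentEdges_iff.1 h
  rcases ht'.1.eq_or_lt with rfl | h1
  · exact (edge_notMem_vertexSet ht (h ▸ edge_neg_one_mem_vertexSet e')).elim
  rcases ht'.2.eq_or_lt with rfl | h2
  · exact (edge_notMem_vertexSet ht (h ▸ edge_one_mem_vertexSet e')).elim
  obtain ⟨rfl, -⟩ := edge_injective ⟨h1, h2⟩ ht h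
  exact he'

/-- The half-edges at a vertex `v` of a graph form a star. -/
lemma isStar_halfEdge (hG : IsFiniteGraph G) {v : G} (hv : v ∈ vertexSet G) :
    IsStar v (HalfEdge.path (v := v)) (vertexSet G ∪ loopMidpoints v) (nonincidentEdges v) := by
  have := hG.finite_cell 1
  have := hG.t2
  have hend (h : HalfEdge v) :
      (edge h.1.1 (-1) = v ∨ edge h.1.1 1 = v) := by
    have := h.2
    rcases endSign_cases h.1.2 with hb | hb <;> rw [hb] at this <;> simp [this]
  have hloop (h : HalfEdge v) (hl : edge h.1.1 (-endSign h.1.2) = v) :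
      edge h.1.1 (-1) = v ∧ edge h.1.1 1 = v := by
    have := h.2
    rcases endSign_cases h.1.2 with hb | hb <;> rw [hb] at this hl <;> simp_all
  have hzero : (0 : ℝ) ∈ Ioo (-1 : ℝ) 1 := by norm_num
  refine
    { finite := inferInstanceAs (Finite {p : cell (univ : Set G) 1 × Bool // _})
      finite_vertices := ?_
      isClosed_rest := ?_
      continuousOn := ?_
      zero := ?_
      one_mem := ?_
      one_ne := ?_
      notMem_vertices := ?_
      notMem_rest := ?_
      injective := ?_
      center_mem := Or.inl hv
      center_notMem := ?_
      cover := ?_ }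
  · refine hG.finite_vertexSet.union ((finite_range fun e => edge e 0).subset ?_)
    intro x hx
    obtain ⟨e, -, rfl⟩ := mem_loopMidpoints_iff.1 hx
    exact ⟨e, rfl⟩
  · exact isClosed_iUnion_of_finite fun e => isClosed_iUnion_of_finite fun _ => isClosed_closedCell
  · intro h
    refine (continuousOn_edge h.1.1).comp (by fun_prop) fun s hs => ?_
    obtain ⟨h0, h1⟩ := hs
    rcases endSign_cases h.1.2 with hb | hb <;> rw [hb] <;> unfold HalfEdge.length <;>
      split_ifs <;> constructor <;> linarith
  · intro h
    simpa [HalfEdge.path] using h.2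
  · intro h
    by_cases hl : edge h.1.1 (-endSign h.1.2) = v
    · refine Or.inr (mem_loopMidpoints_iff.2 ⟨h.1.1, hloop h hl, ?_⟩)
      simp [HalfEdge.path, HalfEdge.length, hl]
    · refine Or.inl ?_
      have : endSign h.1.2 * (1 - h.length * 1) = -endSign h.1.2 := by
        simp only [HalfEdge.length, hl, if_false]
        ring
      rw [HalfEdge.path, this]
      rcases endSign_cases h.1.2 with hb | hb <;> rw [hb]
      · exact edge_neg_one_mem_vertexSet _
      · rw [neg_neg]
        exact edge_one_mem_vertexSet _
  · intro h heq
    by_cases hl : edge h.1.1 (-endSign h.1.2) = v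
    · have : h.path 1 = edge h.1.1 0 := by simp [HalfEdge.path, HalfEdge.length, hl]
      rw [this] at heq
      exact edge_notMem_vertexSet hzero (heq ▸ hv)
    · have : endSign h.1.2 * (1 - h.length * 1) = -endSign h.1.2 := by
        simp only [HalfEdge.length, hl, if_false]
        ring
      rw [HalfEdge.path, this] at heq
      exact hl heq
  · rintro h s hs (hV | hL)
    · exact edge_notMem_vertexSet (h.param_mem hs) hV
    · obtain ⟨e, ⟨he1, he2⟩, he⟩ := mem_loopMidpoints_iff.1 hL
      obtain ⟨h1, h2⟩ := edge_injective (h.param_mem hs) hzero he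
      have hl : edge h.1.1 (-endSign h.1.2) = v := by
        rw [h1]
        rcases endSign_cases h.1.2 with hb | hb <;> simp [hb, he1, he2]
      have hs2 := hs.2
      rw [show h.length = 1 from if_pos hl] at h2
      rcases endSign_cases h.1.2 with hb | hb <;> rw [hb] at h2 <;> linarith
  · intro h s hs hE
    have := edge_interior_mem_nonincidentEdges (h.param_mem hs) hE
    rcases hend h with h' | h'
    · exact this.1 h'
    · exact this.2 h'
  · rintro ⟨⟨e, b⟩, hb⟩ ⟨⟨e', b'⟩, hb'⟩ s hs s' hs' heq
    obtain ⟨rfl, h2⟩ := edge_injective (HalfEdge.param_mem _ hs) (HalfEdge.param_mem _ hs') heq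
    have h0 := hs.2
    have h0' := hs'.2
    have hlen : 0 < HalfEdge.length ⟨(e, b), hb⟩ := by
      unfold HalfEdge.length
      split_ifs <;> norm_num
    have hloop' : HalfEdge.length ⟨(e, b), hb⟩ = 1 ∨ b = b' := by
      by_cases hbb : b = b'
      · exact Or.inr hbb
      · refine Or.inl (if_pos ?_)
        have : -endSign b = endSign b' := by cases b <;> cases b' <;> simp_all [endSign]
        rw [this]
        exact hb'
    have hloop'' : HalfEdge.length ⟨(e, b'), hb'⟩ = 1 ∨ b = b' := by
      by_cases hbb : b = b'
      · exact Or.inr hbb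
      · refine Or.inl (if_pos ?_)
        have : -endSign b' = endSign b := by cases b <;> cases b' <;> simp_all [endSign]
        rw [this]
        exact hb
    -- Two different half-edges of one edge belong to a loop, and have length `1`.
    by_cases hbb : b = b'
    · subst hbb
      refine ⟨rfl, ?_⟩
      have hsign : endSign b ≠ 0 := by rcases endSign_cases b with h | h <;> rw [h] <;> norm_num
      have := mul_left_cancel₀ hsign h2
      exact mul_left_cancel₀ hlen.ne' (by linarith)
    · exfalso
      rw [hloop'.resolve_right hbb, hloop''.resolve_right hbb] at h2
      cases b <;> cases b' <;> simp [endSign] at h2 hbb <;> linarith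
  · intro h
    obtain ⟨e, he, t, ht, hte⟩ := mem_nonincidentEdges_iff.1 h
    rcases ht.1.eq_or_lt with rfl | h1
    · exact he.1 hte
    rcases ht.2.eq_or_lt with rfl | h2
    · exact he.2 hte
    exact edge_notMem_vertexSet ⟨h1, h2⟩ (hte ▸ hv)
  · intro x
    rcases hG.mem_vertexSet_or x with h | ⟨e, t, ht, rfl⟩
    · exact Or.inl (Or.inl h)
    obtain ⟨ht1, ht2⟩ := ht
    by_cases h1 : edge e 1 = v <;> by_cases h2 : edge e (-1) = v
    · rcases lt_trichotomy t 0 with h | rfl | h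
      · refine Or.inr (Or.inr ⟨⟨(e, false), by simpa [endSign] using h2⟩, 1 + t,
          ⟨by linarith, by linarith⟩, ?_⟩)
        simp [HalfEdge.path, HalfEdge.length, endSign, h1]
      · exact Or.inl (Or.inr (mem_loopMidpoints_iff.2 ⟨e, ⟨h2, h1⟩, rfl⟩))
      · refine Or.inr (Or.inr ⟨⟨(e, true), by simpa [endSign] using h1⟩, 1 - t,
          ⟨by linarith, by linarith⟩, ?_⟩)
        simp [HalfEdge.path, HalfEdge.length, endSign, h2]
    · refine Or.inr (Or.inr ⟨⟨(e, true), by simpa [endSign] using h1⟩, (1 - t) / 2,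
        ⟨by linarith, by linarith⟩, ?_⟩)
      simp [HalfEdge.path, HalfEdge.length, endSign, h2]
      congr 1
      ring
    · refine Or.inr (Or.inr ⟨⟨(e, false), by simpa [endSign] using h2⟩, (1 + t) / 2,
        ⟨by linarith, by linarith⟩, ?_⟩)
      simp [HalfEdge.path, HalfEdge.length, endSign, h1]
      congr 1
      ring
    · exact Or.inr (Or.inl (mem_nonincidentEdges_iff.2
        ⟨e, ⟨h2, h1⟩, t, ⟨ht1.le, ht2.le⟩, rfl⟩))

/-- Every component of the union of the edges that are not incident to `v` contains a vertex. -/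
lemma exists_vertex_connectedComponentIn {v x : G} (hx : x ∈ nonincidentEdges v) :
    ∃ w ∈ vertexSet G, w ∈ nonincidentEdges v ∧
      connectedComponentIn (nonincidentEdges v) x =
        connectedComponentIn (nonincidentEdges v) w := by
  obtain ⟨e, he, hxe⟩ := mem_nonincidentEdges_iff.1 hx
  have hw : edge e 1 ∈ edge e '' Icc (-1) 1 := mem_image_of_mem _ (by norm_num)
  refine ⟨edge e 1, edge_one_mem_vertexSet e, mem_nonincidentEdges_iff.2 ⟨e, he, hw⟩, ?_⟩
  refine connectedComponentIn_eq (IsPreconnected.subset_connectedComponentIn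
    (isPreconnected_Icc.image _ (continuousOn_edge e)) hxe ?_ hw)
  exact fun y hy => mem_nonincidentEdges_iff.2 ⟨e, he, hy⟩

end GraphStar

/-! ### The topology of a star -/

namespace IsStar

variable {X : Type} [TopologicalSpace X] {v : X} {H : Type} {P : H → ℝ → X} {V E : Set X}

lemma center_ne (hS : IsStar v P V E) (h : H) {s : ℝ} (hs : s ∈ Ioo (0 : ℝ) 1) : P h s ≠ v :=
  fun heq => hS.notMem_vertices h s hs (heq ▸ hS.center_mem)

/-- A point in the interior of a ray is on a closed ray only if its parameter is the same. -/
lemma eq_of_mem_Icc (hS : IsStar v P V E) {h h' : H} {s s' : ℝ} (hs : s ∈ Ioo (0 : ℝ) 1)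
    (hs' : s' ∈ Icc (0 : ℝ) 1) (heq : P h s = P h' s') : h = h' ∧ s = s' := by
  rcases hs'.1.eq_or_lt with rfl | h0
  · exact (hS.center_ne h hs (heq.trans (hS.zero h'))).elim
  rcases hs'.2.eq_or_lt with rfl | h1
  · exact (hS.notMem_vertices h s hs (heq ▸ hS.one_mem h')).elim
  exact hS.injective h h' s hs s' ⟨h0, h1⟩ heq

lemma disjoint_rays (hS : IsStar v P V E) {h h' : H} (hne : h ≠ h') :
    Disjoint (P h '' Ioo 0 1) (P h' '' Ioo 0 1) := by
  rw [Set.disjoint_left]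
  rintro _ ⟨s, hs, rfl⟩ ⟨s', hs', heq⟩
  exact hne (hS.injective h h' s hs s' hs' heq.symm).1

variable [T2Space X]

/-- The interior of a ray carries the topology of the interval and is open, since its complement is
a finite union of compact sets and the closed rest. -/
lemma isOpen_image (hS : IsStar v P V E) (h : H) {U : Set ℝ} (hU : IsOpen U)
    (hU1 : U ⊆ Ioo 0 1) : IsOpen (P h '' U) := by
  have := hS.finite
  have hcpl : (P h '' U)ᶜ =
      V ∪ E ∪ ((⋃ (h' : H) (_ : h' ≠ h), P h' '' Icc 0 1) ∪ P h '' (Icc 0 1 \ U)) := by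
    ext x
    simp only [mem_compl_iff, mem_union, mem_iUnion]
    constructor
    · intro hx
      rcases hS.cover x with hV | hE | ⟨h', s, hs, rfl⟩
      · exact Or.inl (Or.inl hV)
      · exact Or.inl (Or.inr hE)
      · by_cases hh : h' = h
        · subst hh
          exact Or.inr (Or.inr ⟨s, ⟨Ioo_subset_Icc_self hs, fun hs' => hx ⟨s, hs', rfl⟩⟩, rfl⟩)
        · exact Or.inr (Or.inl ⟨h', hh, s, Ioo_subset_Icc_self hs, rfl⟩)
    · rintro hx ⟨s, hs, rfl⟩
      rcases hx with (hV | hE) | ⟨h', hh, s', hs', heq⟩ | ⟨s', hs', heq⟩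
      · exact hS.notMem_vertices h s (hU1 hs) hV
      · exact hS.notMem_rest h s (hU1 hs) hE
      · exact hh (hS.eq_of_mem_Icc (hU1 hs) hs' heq.symm).1.symm
      · exact hs'.2 ((hS.eq_of_mem_Icc (hU1 hs) hs'.1 heq.symm).2 ▸ hs)
  have hK (h' : H) {K : Set ℝ} (hK : IsCompact K) (hK1 : K ⊆ Icc 0 1) : IsClosed (P h' '' K) :=
    (hK.image_of_continuousOn ((hS.continuousOn h').mono hK1)).isClosed
  rw [← isClosed_compl_iff, hcpl]
  refine (hS.finite_vertices.isClosed.union hS.isClosed_rest).union (IsClosed.union ?_ ?_)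
  · exact isClosed_iUnion_of_finite fun h' => isClosed_iUnion_of_finite fun _ =>
      hK h' isCompact_Icc subset_rfl
  · exact hK h (isCompact_Icc.diff hU) sdiff_subset

/-- The open star of `v`. -/
lemma isOpen_star (hS : IsStar v P V E) : IsOpen ({v} ∪ ⋃ h, P h '' Ioo 0 1) := by
  have hcpl : ({v} ∪ ⋃ h, P h '' Ioo 0 1)ᶜ = E ∪ V \ {v} := by
    ext x
    simp only [mem_compl_iff, mem_union, mem_singleton_iff, mem_iUnion, mem_sdiff, not_or]
    constructor
    · rintro ⟨hxv, hx⟩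
      rcases hS.cover x with hV | hE | ⟨h, s, hs, rfl⟩
      · exact Or.inr ⟨hV, hxv⟩
      · exact Or.inl hE
      · exact (hx ⟨h, s, hs, rfl⟩).elim
    · rintro (hE | ⟨hV, hxv⟩)
      · refine ⟨fun hxv => hS.center_notMem (hxv ▸ hE), ?_⟩
        rintro ⟨h, s, hs, rfl⟩
        exact hS.notMem_rest h s hs hE
      · refine ⟨hxv, ?_⟩
        rintro ⟨h, s, hs, rfl⟩
        exact hS.notMem_vertices h s hs hV
  rw [← isClosed_compl_iff, hcpl]
  exact hS.isClosed_rest.union (hS.finite_vertices.subset sdiff_subset).isClosed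

/-- A connected subset of the open star that avoids `v` is contained in one ray. -/
lemma exists_ray (hS : IsStar v P V E) {B : Set X} (hB : IsPreconnected B) (hne : B.Nonempty)
    (hsub : B ⊆ ⋃ h, P h '' Ioo 0 1) : ∃ h, B ⊆ P h '' Ioo 0 1 := by
  obtain ⟨x, hx⟩ := hne
  obtain ⟨h, hxh⟩ := mem_iUnion.1 (hsub hx)
  refine ⟨h, IsPreconnected.subset_left_of_subset_union (hS.isOpen_image h isOpen_Ioo subset_rfl)
    (v := ⋃ (h' : H) (_ : h' ≠ h), P h' '' Ioo 0 1) ?_ ?_ ?_ ⟨x, hx, hxh⟩ hB⟩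
  · exact isOpen_iUnion fun h' => isOpen_iUnion fun _ => hS.isOpen_image h' isOpen_Ioo subset_rfl
  · simp only [disjoint_iUnion_right]
    exact fun h' hh => hS.disjoint_rays hh.symm
  · intro y hy
    obtain ⟨h', hy'⟩ := mem_iUnion.1 (hsub hy)
    by_cases hh : h' = h
    · exact Or.inl (hh ▸ hy')
    · exact Or.inr (mem_iUnion.2 ⟨h', mem_iUnion.2 ⟨hh, hy'⟩⟩)

/-- A connected set that contains `v` and a point of a ray, but not the end of the ray, contains
the whole segment in between. -/
lemma segment_subset (hS : IsStar v P V E) {A : Set X} (hA : IsPreconnected A) (hv : v ∈ A) {h : H}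
    {s₀ : ℝ} (hs₀ : s₀ ∈ Ioo (0 : ℝ) 1) (h₀ : P h s₀ ∈ A) (h₁ : P h 1 ∉ A) :
    P h '' Ioo 0 s₀ ⊆ A := by
  rintro _ ⟨s, hs, rfl⟩
  by_contra hsA
  have hs1 : s ∈ Ioo (0 : ℝ) 1 := ⟨hs.1, hs.2.trans hs₀.2⟩
  have hclosed : IsClosed (P h '' Icc s 1) :=
    (isCompact_Icc.image_of_continuousOn
      ((hS.continuousOn h).mono (Icc_subset_Icc_left hs.1.le))).isClosed
  have hsub := IsPreconnected.subset_left_of_subset_union (s := A)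
    (hS.isOpen_image h (isOpen_Ioo (a := s) (b := 1)) (Ioo_subset_Ioo_left hs.1.le))
    hclosed.isOpen_compl
    (disjoint_compl_right_iff_subset.2 (image_mono Ioo_subset_Icc_self)) ?_
    ⟨_, h₀, s₀, ⟨hs.2, hs₀.2⟩, rfl⟩ hA
  · obtain ⟨s', hs', heq⟩ := hsub hv
    exact hS.center_ne h ⟨hs.1.trans hs'.1, hs'.2⟩ heq
  · intro x hx
    by_cases hx' : x ∈ P h '' Icc s 1
    · obtain ⟨s', hs', rfl⟩ := hx'
      refine Or.inl ⟨s', ⟨hs'.1.lt_of_ne ?_, hs'.2.lt_of_ne ?_⟩, rfl⟩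
      · rintro rfl
        exact hsA hx
      · rintro rfl
        exact h₁ hx
    · exact Or.inr hx'

/-- Continuous maps on a star can be defined ray by ray. -/
lemma exists_continuousMap (hS : IsStar v P V ∅) {Z : Type} [TopologicalSpace Z] (f : X → Z)
    (g : H → ℝ → Z) (hg : ∀ h, ContinuousOn (g h) (Icc 0 1)) (hg₀ : ∀ h, g h 0 = f v)
    (hg₁ : ∀ h, g h 1 = f (P h 1)) :
    ∃ F : C(X, Z), (∀ x ∈ V, F x = f x) ∧ ∀ h, ∀ s ∈ Icc (0 : ℝ) 1, F (P h s) = g h s := by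
  classical
  have := hS.finite
  let F : X → Z := fun x =>
    if hx : ∃ p : H × ℝ, p.2 ∈ Ioo (0 : ℝ) 1 ∧ x = P p.1 p.2 then g hx.choose.1 hx.choose.2 else f x
  have hFV : ∀ x ∈ V, F x = f x := by
    refine fun x hx => dif_neg ?_
    rintro ⟨p, hp, rfl⟩
    exact hS.notMem_vertices _ _ hp hx
  have hFP : ∀ h, ∀ s ∈ Icc (0 : ℝ) 1, F (P h s) = g h s := by
    intro h s hs
    rcases hs.1.eq_or_lt with rfl | h0
    · rw [hS.zero, hFV v hS.center_mem, hg₀]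
    rcases hs.2.eq_or_lt with rfl | h1
    · rw [hFV _ (hS.one_mem h), hg₁]
    have hx : ∃ p : H × ℝ, p.2 ∈ Ioo (0 : ℝ) 1 ∧ P h s = P p.1 p.2 := ⟨(h, s), ⟨h0, h1⟩, rfl⟩
    obtain ⟨e1, e2⟩ := hS.injective _ _ s ⟨h0, h1⟩ _ hx.choose_spec.1 hx.choose_spec.2
    exact (dif_pos hx).trans (by rw [← e1, ← e2])
  refine ⟨⟨F, continuous_iff_isClosed.2 fun C hC => ?_⟩, hFV, hFP⟩
  -- The preimage of a closed set is a finite union of compact sets.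
  have hpre : F ⁻¹' C = (V ∩ F ⁻¹' C) ∪ ⋃ h, P h '' (Icc 0 1 ∩ g h ⁻¹' C) := by
    ext x
    simp only [mem_union, mem_iUnion]
    constructor
    · intro hx
      rcases hS.cover x with hV | hE | ⟨h, s, hs, rfl⟩
      · exact Or.inl ⟨hV, hx⟩
      · exact hE.elim
      · refine Or.inr ⟨h, s, ⟨Ioo_subset_Icc_self hs, ?_⟩, rfl⟩
        rwa [mem_preimage, ← hFP h s (Ioo_subset_Icc_self hs)]
    · rintro (hx | ⟨h, s, ⟨hs, hsC⟩, rfl⟩)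
      · exact hx.2
      · rwa [mem_preimage, hFP h s hs]
  rw [hpre]
  refine (hS.finite_vertices.subset inter_subset_left).isClosed.union
    (isClosed_iUnion_of_finite fun h => ?_)
  exact ((isCompact_Icc.of_isClosed_subset ((hg h).preimage_isClosed_of_isClosed isClosed_Icc hC)
    inter_subset_left).image_of_continuousOn
      ((hS.continuousOn h).mono inter_subset_left)).isClosed

end IsStar

/-! ### Stars as graphs -/

namespace IsStar

variable {X : Type} [TopologicalSpace X] {v : X} {H : Type} {P : H → ℝ → X} {V : Set X}

/-- The affine parameter of the ray at a point of the one-dimensional ball. -/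
def rayParameter (y : Fin 1 → ℝ) : ℝ := (1 + y 0) / 2

lemma continuous_rayParameter : Continuous rayParameter := by
  unfold rayParameter
  fun_prop

lemma rayParameter_mem_Ioo {y : Fin 1 → ℝ} (hy : y ∈ Metric.ball (0 : Fin 1 → ℝ) 1) :
    rayParameter y ∈ Ioo (0 : ℝ) 1 := by
  obtain ⟨t, rfl⟩ := exists_eq_const_fin_one y
  rw [mem_ball_zero_iff, norm_const_fin_one, abs_lt] at hy
  constructor <;> simp only [rayParameter] <;> linarith

lemma rayParameter_mem_Icc {y : Fin 1 → ℝ} (hy : y ∈ Metric.closedBall (0 : Fin 1 → ℝ) 1) :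
    rayParameter y ∈ Icc (0 : ℝ) 1 := by
  obtain ⟨t, rfl⟩ := exists_eq_const_fin_one y
  rw [mem_closedBall_zero_iff, norm_const_fin_one, abs_le] at hy
  constructor <;> simp only [rayParameter] <;> linarith

lemma rayParameter_injective : Function.Injective rayParameter := by
  intro y y' h
  ext i
  rw [Subsingleton.elim i 0]
  simp only [rayParameter] at h
  linarith

lemma rayParameter_const (s : ℝ) : rayParameter (fun _ => 2 * s - 1) = s := by
  simp only [rayParameter]
  ring

lemma injOn_ray (hS : IsStar v P V ∅) (h : H) :
    InjOn (fun y => P h (rayParameter y)) (Metric.ball 0 1) := fun _ hy _ hy' heq =>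
  rayParameter_injective
    (hS.injective h h _ (rayParameter_mem_Ioo hy) _ (rayParameter_mem_Ioo hy') heq).2

/-- The cells of a star without rest: its vertices and its rays. -/
def StarCell (V : Set X) (H : Type) : ℕ → Type
  | 0 => V
  | 1 => H
  | _ + 2 => Empty

/-- The characteristic maps of the cells of a star. -/
def starMap (hS : IsStar v P V ∅) : (n : ℕ) → StarCell V H n → PartialEquiv (Fin n → ℝ) X
  | 0, x => PartialEquiv.single ![] x.1
  | 1, h => (hS.injOn_ray h).toPartialEquiv
  | _ + 2, e => e.elim

lemma starMap_one_apply (hS : IsStar v P V ∅) (h : H) (y : Fin 1 → ℝ) :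
    starMap hS 1 h y = P h (rayParameter y) := rfl

lemma starMap_one_image (hS : IsStar v P V ∅) (h : H) :
    starMap hS 1 h '' Metric.closedBall 0 1 = P h '' Icc 0 1 := by
  ext x
  constructor
  · rintro ⟨y, hy, rfl⟩
    exact ⟨_, rayParameter_mem_Icc hy, rfl⟩
  · rintro ⟨s, hs, rfl⟩
    refine ⟨fun _ => 2 * s - 1, ?_, by rw [starMap_one_apply, rayParameter_const]⟩
    rw [mem_closedBall_zero_iff, norm_const_fin_one, abs_le]
    obtain ⟨h0, h1⟩ := hs
    constructor <;> linarith

variable [T2Space X]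

/-- A star without rest is a CW complex, with the rays as edges. -/
@[reducible]
def cwComplex (hS : IsStar v P V ∅) : CWComplex (univ : Set X) := by
  refine CWComplex.mkFinite univ (StarCell V H) (starMap hS) ?_ ?_ ?_ ?_ ?_ ?_ ?_ ?_
  · exact Filter.eventually_atTop.2 ⟨2, fun n hn => by
      obtain ⟨k, rfl⟩ := Nat.exists_eq_add_of_le' hn
      exact inferInstanceAs (IsEmpty Empty)⟩
  · rintro (_ | _ | n)
    · exact hS.finite_vertices
    · exact hS.finite
    · exact inferInstanceAs (Finite Empty)
  · rintro (_ | _ | n) i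
    · ext y
      simp [starMap, Subsingleton.elim y 0]
    · rfl
    · exact i.elim
  · rintro (_ | _ | n) i
    · exact continuousOn_const
    · exact (hS.continuousOn i).comp continuous_rayParameter.continuousOn
        fun y hy => rayParameter_mem_Icc hy
    · exact i.elim
  · rintro (_ | _ | n) i
    · exact continuousOn_const
    · have himage {U : Set (Fin 1 → ℝ)} (hU : IsOpen U) (hU1 : U ⊆ Metric.ball 0 1) :
          IsOpen (starMap hS 1 i '' U) := by
        have : starMap hS 1 i '' U = P i '' {s | (fun _ => 2 * s - 1 : Fin 1 → ℝ) ∈ U} := by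
          ext x
          constructor
          · rintro ⟨y, hy, rfl⟩
            refine ⟨rayParameter y, ?_, rfl⟩
            rw [mem_ofPred_eq]
            convert hy
            rename_i k
            rw [Subsingleton.elim k 0]
            simp only [rayParameter]
            ring
          · rintro ⟨s, hs, rfl⟩
            exact ⟨_, hs, congrArg (P i) (rayParameter_const s)⟩
        rw [this]
        refine hS.isOpen_image i (hU.preimage (by fun_prop)) fun s hs => ?_
        have := rayParameter_mem_Ioo (hU1 hs)
        rwa [rayParameter_const] at this
      have htarget : (starMap hS 1 i).target = starMap hS 1 i '' Metric.ball 0 1 := rfl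
      refine (continuousOn_open_iff (htarget ▸ himage Metric.isOpen_ball subset_rfl)).2
        fun t ht => ?_
      rw [← PartialEquiv.image_source_inter_eq']
      exact himage (Metric.isOpen_ball.inter ht) inter_subset_left
    · exact i.elim
  · rintro ⟨_ | _ | n, i⟩ - ⟨_ | _ | m, j⟩ - hne
    · rw [Function.onFun, Set.disjoint_left]
      rintro _ ⟨y, hy, rfl⟩ ⟨y', hy', heq⟩
      have hij : j = i := Subtype.ext heq
      exact hne (by rw [hij])
    · rw [Function.onFun, Set.disjoint_left]
      rintro _ ⟨y, hy, rfl⟩ ⟨y', hy', heq⟩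
      have hi : P j (rayParameter y') = i.1 := heq
      exact hS.notMem_vertices j _ (rayParameter_mem_Ioo hy') (hi ▸ i.2)
    · exact j.elim
    · rw [Function.onFun, Set.disjoint_left]
      rintro _ ⟨y, hy, rfl⟩ ⟨y', hy', heq⟩
      have hj : j.1 = P i (rayParameter y) := heq
      exact hS.notMem_vertices i _ (rayParameter_mem_Ioo hy) (hj ▸ j.2)
    · rw [Function.onFun, Set.disjoint_left]
      rintro _ ⟨y, hy, rfl⟩ ⟨y', hy', heq⟩
      have := (hS.injective _ _ _ (rayParameter_mem_Ioo hy') _ (rayParameter_mem_Ioo hy) heq).1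
      exact hne (by rw [show i = j from this.symm])
    · exact j.elim
    · exact i.elim
    · exact i.elim
    · exact i.elim
  · rintro (_ | _ | n) i
    · intro y hy
      rw [mem_sphere_zero_iff_norm, Subsingleton.elim y 0, norm_zero] at hy
      norm_num at hy
    · intro y hy
      have hmem : starMap hS 1 i y ∈ V := by
        obtain ⟨t, rfl⟩ := exists_eq_const_fin_one y
        rw [mem_sphere_zero_iff_norm, norm_const_fin_one] at hy
        change P i (rayParameter _) ∈ V
        rcases eq_or_eq_neg_of_abs_eq hy with rfl | rfl
        · rw [show rayParameter (fun _ => 1) = 1 by norm_num [rayParameter]]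
          exact hS.one_mem i
        · rw [show rayParameter (fun _ => -1) = 0 by norm_num [rayParameter]]
          exact hS.zero i ▸ hS.center_mem
      simp only [mem_iUnion]
      exact ⟨0, one_pos, ⟨_, hmem⟩, 0, by simp, rfl⟩
    · exact i.elim
  · refine eq_univ_of_forall fun x => ?_
    simp only [mem_iUnion]
    rcases hS.cover x with hV | hE | ⟨h, s, hs, rfl⟩
    · exact ⟨0, ⟨x, hV⟩, 0, by simp, rfl⟩
    · exact hE.elim
    · exact ⟨1, h, by
        rw [starMap_one_image hS h]
        exact ⟨s, Ioo_subset_Icc_self hs, rfl⟩⟩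

/-- A star without rest is a finite graph with vertices `V`. -/
lemma isFiniteGraph (hS : IsStar v P V ∅) :
    letI := hS.cwComplex
    IsFiniteGraph X ∧ vertexSet X = V := by
  let := hS.cwComplex
  refine ⟨⟨inferInstance, CWComplex.finite_mkFinite _ _ _ _ _ _ _ _ _ _ _, fun n hn => ?_⟩, ?_⟩
  · obtain ⟨k, rfl⟩ := Nat.exists_eq_add_of_le' hn
    exact inferInstanceAs (IsEmpty Empty)
  · ext x
    rw [vertexSet, mem_iUnion]
    constructor
    · rintro ⟨i, y, hy, rfl⟩
      exact i.2
    · intro hx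
      exact ⟨⟨x, hx⟩, 0, by simp, rfl⟩

end IsStar

/-! ### Collapsing the components of a closed set -/

section Collapse

variable {X : Type} [TopologicalSpace X]

lemma isClosed_connectedComponentIn {E : Set X} (hE : IsClosed E) (x : X) :
    IsClosed (connectedComponentIn E x) := by
  by_cases hx : x ∈ E
  · refine closure_subset_iff_isClosed.1 ?_
    exact isPreconnected_connectedComponentIn.closure.subset_connectedComponentIn
      (subset_closure (mem_connectedComponentIn hx))
      (closure_minimal (connectedComponentIn_subset E x) hE)
  · rw [connectedComponentIn_eq_empty hx]
    exact isClosed_empty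

/-- The equivalence relation that identifies the points of each component of `E`. -/
def collapseSetoid (E : Set X) : Setoid X where
  r x y := x = y ∨ (x ∈ E ∧ y ∈ E ∧ connectedComponentIn E x = connectedComponentIn E y)
  iseqv :=
    { refl := fun _ => Or.inl rfl
      symm := by
        rintro x y (rfl | ⟨hx, hy, h⟩)
        · exact Or.inl rfl
        · exact Or.inr ⟨hy, hx, h.symm⟩
      trans := by
        rintro x y z (rfl | ⟨hx, hy, h⟩) (rfl | ⟨hy', hz, h'⟩)
        · exact Or.inl rfl
        · exact Or.inr ⟨hy', hz, h'⟩
        · exact Or.inr ⟨hx, hy, h⟩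
        · exact Or.inr ⟨hx, hz, h.trans h'⟩ }

/-- The space obtained by collapsing each component of `E` to a point. -/
abbrev Collapse (E : Set X) : Type := Quotient (collapseSetoid E)

/-- The collapsing map. -/
def Collapse.proj (E : Set X) : C(X, Collapse E) := ⟨Quotient.mk _, continuous_quotient_mk'⟩

lemma Collapse.isQuotientMap_proj (E : Set X) : IsQuotientMap (Collapse.proj E) :=
  isQuotientMap_quotient_mk'

lemma Collapse.surjective_proj (E : Set X) : Function.Surjective (Collapse.proj E) :=
  (Collapse.isQuotientMap_proj E).surjective

variable {E V : Set X}

lemma Collapse.proj_eq_iff {x y : X} : proj E x = proj E y ↔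
    x = y ∨ (x ∈ E ∧ y ∈ E ∧ connectedComponentIn E x = connectedComponentIn E y) :=
  Quotient.eq

lemma Collapse.proj_eq_iff_of_notMem {x y : X} (hy : y ∉ E) : proj E x = proj E y ↔ x = y := by
  rw [proj_eq_iff]
  tauto

variable (hE : IsClosed E) (hV : V.Finite) (hEV : ∀ x ∈ E, ∃ w ∈ V, w ∈ E ∧
  connectedComponentIn E x = connectedComponentIn E w)

include hE hV hEV in
/-- Since `E` has only finitely many components, collapsing them is a closed map. -/
lemma Collapse.isClosedMap_proj : IsClosedMap (proj E) := by
  intro C hC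
  rw [← (isQuotientMap_proj E).isClosed_preimage]
  have hpre : proj E ⁻¹' (proj E '' C) = C ∪ ⋃ w ∈ {w ∈ V | w ∈ E ∧
      (connectedComponentIn E w ∩ C).Nonempty}, connectedComponentIn E w := by
    ext x
    simp only [mem_preimage, mem_image, mem_union, mem_iUnion, proj_eq_iff, mem_ofPred_eq]
    constructor
    · rintro ⟨y, hy, rfl | ⟨hyE, hxE, h⟩⟩
      · exact Or.inl hy
      · obtain ⟨w, hwV, hwE, hw⟩ := hEV x hxE
        refine Or.inr ⟨w, ⟨hwV, hwE, y, ?_, hy⟩, hw ▸ mem_connectedComponentIn hxE⟩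
        rw [← hw, ← h]
        exact mem_connectedComponentIn hyE
    · rintro (hx | ⟨w, ⟨-, -, y, hyw, hy⟩, hx⟩)
      · exact ⟨x, hx, Or.inl rfl⟩
      · refine ⟨y, hy, Or.inr ⟨connectedComponentIn_subset _ _ hyw,
          connectedComponentIn_subset _ _ hx, ?_⟩⟩
        rw [← connectedComponentIn_eq hyw, ← connectedComponentIn_eq hx]
  rw [hpre]
  exact hC.union ((hV.subset fun w hw => hw.1).isClosed_biUnion
    fun w _ => isClosed_connectedComponentIn hE w)

include hE hV hEV in
lemma Collapse.t2Space [T2Space X] [CompactSpace X] : T2Space (Collapse E) := by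
  have hclosed := Collapse.isClosedMap_proj hE hV hEV
  -- The square of a proper map is closed, and maps the diagonal onto the diagonal.
  have hproper : IsProperMap (proj E) := by
    refine isProperMap_iff_isClosedMap_and_compact_fibers.2
      ⟨(proj E).continuous, hclosed, fun y => ?_⟩
    obtain ⟨x, rfl⟩ := surjective_proj E y
    have : IsClosed ({proj E x} : Set (Collapse E)) := by
      simpa using hclosed _ (isClosed_singleton (x := x))
    exact (this.preimage (proj E).continuous).isCompact
  rw [t2_iff_isClosed_diagonal]
  have : diagonal (Collapse E) = Prod.map (proj E) (proj E) '' diagonal X := by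
    ext ⟨a, b⟩
    constructor
    · intro h
      obtain rfl : a = b := h
      obtain ⟨x, rfl⟩ := surjective_proj E a
      exact ⟨(x, x), rfl, rfl⟩
    · rintro ⟨⟨x, y⟩, h, heq⟩
      obtain rfl : x = y := h
      rw [← heq]
      rfl
  rw [this]
  exact (hproper.prodMap hproper).isClosedMap _ isClosed_diagonal

include hEV in
/-- Collapsing the components of the rest of a star yields a star without rest. -/
lemma IsStar.collapse {v : X} {H : Type} {P : H → ℝ → X} (hS : IsStar v P V E) :
    IsStar (Collapse.proj E v) (fun h s => Collapse.proj E (P h s)) (Collapse.proj E '' V) ∅ where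
  finite := hS.finite
  finite_vertices := hS.finite_vertices.image _
  isClosed_rest := isClosed_empty
  continuousOn h := (Collapse.proj E).continuous.comp_continuousOn (hS.continuousOn h)
  zero h := by rw [hS.zero]
  one_mem h := mem_image_of_mem _ (hS.one_mem h)
  one_ne h heq := hS.one_ne h ((Collapse.proj_eq_iff_of_notMem hS.center_notMem).1 heq)
  notMem_vertices := by
    rintro h s hs ⟨w, hw, heq⟩
    rw [(Collapse.proj_eq_iff_of_notMem (hS.notMem_rest h s hs)).1 heq] at hw
    exact hS.notMem_vertices h s hs hw
  notMem_rest _ _ _ h := h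
  injective h h' s hs s' hs' heq := hS.injective h h' s hs s' hs'
    ((Collapse.proj_eq_iff_of_notMem (hS.notMem_rest h' s' hs')).1 heq)
  center_mem := mem_image_of_mem _ hS.center_mem
  center_notMem h := h
  cover y := by
    obtain ⟨x, rfl⟩ := Collapse.surjective_proj E y
    rcases hS.cover x with hx | hx | ⟨h, s, hs, rfl⟩
    · exact Or.inl (mem_image_of_mem _ hx)
    · obtain ⟨w, hwV, hwE, hw⟩ := hEV x hx
      exact Or.inl ⟨w, hwV, Collapse.proj_eq_iff.2 (Or.inr ⟨hwE, hx, hw.symm⟩)⟩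
    · exact Or.inr (Or.inr ⟨h, s, hs, rfl⟩)

end Collapse

/-! ### The sink collapse of a graph -/

section SinkCollapse

variable {G : Type} [TopologicalSpace G] [CWComplex (univ : Set G)]

lemma exists_mem_connectedComponentIn {v : G} : ∀ x ∈ nonincidentEdges v,
    ∃ w ∈ vertexSet G ∪ loopMidpoints v, w ∈ nonincidentEdges v ∧
      connectedComponentIn (nonincidentEdges v) x =
        connectedComponentIn (nonincidentEdges v) w := fun _ hx =>
  let ⟨w, hw, h⟩ := exists_vertex_connectedComponentIn hx
  ⟨w, Or.inl hw, h⟩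

lemma t2Space_collapse (hG : IsFiniteGraph G) {v : G} (hv : v ∈ vertexSet G) :
    T2Space (Collapse (nonincidentEdges v)) := by
  have := hG.t2
  have := hG.compactSpace
  have hS := isStar_halfEdge hG hv
  exact Collapse.t2Space hS.isClosed_rest hS.finite_vertices exists_mem_connectedComponentIn

lemma isStar_collapse (hG : IsFiniteGraph G) {v : G} (hv : v ∈ vertexSet G) :
    IsStar (Collapse.proj (nonincidentEdges v) v)
      (fun (h : HalfEdge v) s => Collapse.proj (nonincidentEdges v) (h.path s))
      (Collapse.proj (nonincidentEdges v) '' (vertexSet G ∪ loopMidpoints v)) ∅ :=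
  (isStar_halfEdge hG hv).collapse exists_mem_connectedComponentIn

/-- The quotient of a graph by the components of the edges not incident to `v` is a graph, and the
collapsing map makes it a sink collapse. -/
lemma exists_cwComplex_isSinkCollapse (hG : IsFiniteGraph G) {v : G} (hv : v ∈ vertexSet G) :
    ∃ _ : CWComplex (univ : Set (Collapse (nonincidentEdges v))),
      IsFiniteGraph (Collapse (nonincidentEdges v)) ∧
      IsSinkCollapse v (Collapse.proj (nonincidentEdges v))
        ((Collapse.proj (nonincidentEdges v) '' (vertexSet G ∪ loopMidpoints v)) \
          {Collapse.proj (nonincidentEdges v) v}) := by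
  have := t2Space_collapse hG hv
  let := (isStar_collapse hG hv).cwComplex
  obtain ⟨hQ, hVQ⟩ := (isStar_collapse hG hv).isFiniteGraph
  refine ⟨inferInstance, hQ, Collapse.isQuotientMap_proj _, fun _ _ => Collapse.proj_eq_iff, hVQ,
    by rw [hVQ], fun x y hxy h => ?_⟩
  obtain rfl | ⟨hx, -, -⟩ := Collapse.proj_eq_iff.1 h
  · exact (hxy rfl).elim
  obtain ⟨w, hwV, hwE, hw⟩ := exists_mem_connectedComponentIn x hx
  refine ⟨⟨w, hwV, Collapse.proj_eq_iff.2 (Or.inr ⟨hwE, hx, hw.symm⟩)⟩, fun hxv => ?_⟩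
  have hvE := (isStar_halfEdge hG hv).center_notMem
  exact hvE ((Collapse.proj_eq_iff_of_notMem hvE).1 hxv ▸ hx)

end SinkCollapse

/-! ### Functions that detect the arms of a star -/

section Detect

variable {X : Type} [TopologicalSpace X] [T2Space X] {v : X} {H : Type} {P : H → ℝ → X} {V : Set X}

/-- Two functions on a star without rest. The unit complex number `σ` turns once through the upper
half-plane along the ray `a`, and through the lower half-plane along all other rays. The real
number `t` grows along those rays that end where `c` ends, and decreases along all other rays. -/
lemma IsStar.exists_detecting (hS : IsStar v P V ∅) (a c : H) :
    ∃ (σ : C(X, ℂ)) (t : C(X, ℝ)), (∀ x, ‖σ x‖ = 1) ∧ (∀ x, σ x = 1 ↔ x = v) ∧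
      (∀ x, |t x| ≤ 1) ∧ (∀ x, t x = 0 ↔ x = v) ∧
      (∀ s ∈ Icc (0 : ℝ) 1, 0 ≤ (σ (P a s)).im) ∧
      (∀ h ≠ a, ∀ s ∈ Icc (0 : ℝ) 1, (σ (P h s)).im ≤ 0) ∧
      (∀ s ∈ Icc (0 : ℝ) 1, t (P c s) = s) ∧
      ∀ h, P h 1 ≠ P c 1 → ∀ s ∈ Icc (0 : ℝ) 1, t (P h s) = -s := by
  classical
  let sign : H → ℝ := fun h => if h = a then 1 else -1
  have hsign (h) : sign h = 1 ∨ sign h = -1 := by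
    by_cases hh : h = a
    · exact Or.inl (if_pos hh)
    · exact Or.inr (if_neg hh)
  let sign' : H → ℝ := fun h => if P h 1 = P c 1 then 1 else -1
  have hsign' (h) : sign' h = 1 ∨ sign' h = -1 := by
    by_cases hh : P h 1 = P c 1
    · exact Or.inl (if_pos hh)
    · exact Or.inr (if_neg hh)
  obtain ⟨σ, hσV, hσ⟩ := hS.exists_continuousMap (fun x => if x = v then (1 : ℂ) else -1)
    (fun h s => ⟨Real.cos (Real.pi * s), sign h * Real.sin (Real.pi * s)⟩)
    (fun h => by
      have : (fun s : ℝ => (⟨Real.cos (Real.pi * s), sign h * Real.sin (Real.pi * s)⟩ : ℂ)) =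
          fun s : ℝ => ((Real.cos (Real.pi * s) : ℝ) : ℂ) +
            ((sign h * Real.sin (Real.pi * s) : ℝ) : ℂ) * Complex.I := by
        ext s
        exact Complex.mk_eq_add_mul_I _ _
      rw [this]
      fun_prop)
    (fun h => by apply Complex.ext <;> simp)
    (fun h => by apply Complex.ext <;> simp [hS.one_ne h])
  obtain ⟨t, htV, ht⟩ := hS.exists_continuousMap
    (fun x => if x = v then (0 : ℝ) else if x = P c 1 then 1 else -1)
    (fun h s => sign' h * s) (fun h => by fun_prop) (fun h => by simp)
    (fun h => by simp [hS.one_ne h, sign'])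
  have hIcc {s : ℝ} (hs : s ∈ Ioo (0 : ℝ) 1) : s ∈ Icc (0 : ℝ) 1 := Ioo_subset_Icc_self hs
  have hsin {s : ℝ} (hs : s ∈ Icc (0 : ℝ) 1) : 0 ≤ Real.sin (Real.pi * s) :=
    Real.sin_nonneg_of_nonneg_of_le_pi (mul_nonneg Real.pi_pos.le hs.1)
      (mul_le_of_le_one_right Real.pi_pos.le hs.2)
  have hσv : σ v = 1 := by rw [hσV v hS.center_mem, if_pos rfl]
  have htv : t v = 0 := by rw [htV v hS.center_mem, if_pos rfl]
  refine ⟨σ, t, fun x => ?_, fun x => ⟨fun hx => ?_, fun h => h ▸ hσv⟩, fun x => ?_,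
    fun x => ⟨fun hx => ?_, fun h => h ▸ htv⟩, fun s hs => ?_, fun h hh s hs => ?_,
    fun s hs => ?_, fun h hh s hs => ?_⟩
  · rcases hS.cover x with hV | hE | ⟨h, s, hs, rfl⟩
    · rw [hσV x hV]
      split_ifs <;> simp
    · exact hE.elim
    · rw [hσ h s (hIcc hs), ← pow_eq_one_iff_of_nonneg (norm_nonneg _) two_ne_zero,
        Complex.sq_norm, Complex.normSq_mk]
      have := Real.cos_sq_add_sin_sq (Real.pi * s)
      rcases hsign h with h | h <;> rw [h] <;> linarith
  · rcases hS.cover x with hV | hE | ⟨h, s, hs, rfl⟩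
    · rw [hσV x hV] at hx
      by_contra hxv
      rw [if_neg hxv] at hx
      norm_num at hx
    · exact hE.elim
    · rw [hσ h s (hIcc hs)] at hx
      have him := congrArg Complex.im hx
      have hpos := Real.sin_pos_of_pos_of_lt_pi (mul_pos Real.pi_pos hs.1)
        (mul_lt_of_lt_one_right Real.pi_pos hs.2)
      rcases hsign h with h | h <;> simp [h, hpos.ne'] at him
  · rcases hS.cover x with hV | hE | ⟨h, s, hs, rfl⟩
    · rw [htV x hV]
      split_ifs <;> simp
    · exact hE.elim
    · rw [ht h s (hIcc hs)]
      rcases hsign' h with h | h <;> rw [h] <;> simp [abs_of_pos hs.1, hs.2.le]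
  · rcases hS.cover x with hV | hE | ⟨h, s, hs, rfl⟩
    · rw [htV x hV] at hx
      by_contra hxv
      rw [if_neg hxv] at hx
      split_ifs at hx <;> norm_num at hx
    · exact hE.elim
    · rw [ht h s (hIcc hs)] at hx
      have := hs.1.ne'
      rcases hsign' h with h | h <;> simp [h, this] at hx
  · rw [hσ a s hs]
    simpa [sign] using hsin hs
  · rw [hσ h s hs]
    simpa [sign, hh] using hsin hs
  · rw [ht c s hs]
    simp [sign']
  · rw [ht h s hs]
    simp [sign', hh]

end Detect

/-- The detecting function of two particles on a star vanishes only if both of them are in the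
centre. -/
lemma eq_center_of_add_eq_zero {X : Type} {v : X} {σ : X → ℂ} {t : X → ℝ} (hσ : ∀ x, ‖σ x‖ = 1)
    (hσv : ∀ x, σ x = 1 ↔ x = v) (ht : ∀ x, |t x| ≤ 1) (htv : ∀ x, t x = 0 ↔ x = v) {x y : X}
    (h : σ x - 1 + t y = 0) : x = v ∧ y = v := by
  have hre : σ x = ((1 - t y : ℝ) : ℂ) := by
    push_cast
    linear_combination h
  have hn := hσ x
  have hty := abs_le.1 (ht y)
  rw [hre, Complex.norm_real, Real.norm_of_nonneg (by linarith)] at hn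
  have h0 : t y = 0 := by linarith
  refine ⟨(hσv x).1 ?_, (htv y).1 h0⟩
  rw [hre, h0]
  simp

/-! ### The degree of the detecting function on the exchange loop -/

section Degree

/-- The reflection of the circle that exchanges the real and the imaginary axis. -/
def circleReflection : Circle ≃ₜ Circle :=
  (Homeomorph.inv Circle).trans (Homeomorph.mulLeft ⟨Complex.I, by simp [Submonoid.unitSphere]⟩)

lemma coe_circleReflection (z : Circle) :
    (circleReflection z : ℂ) = ⟨(z : ℂ).im, (z : ℂ).re⟩ := by
  change Complex.I * ((z⁻¹ : Circle) : ℂ) = _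
  rw [Circle.coe_inv_eq_conj]
  apply Complex.ext <;> simp

lemma circle_re_im_ne_zero (z : Circle) (hre : (z : ℂ).re = 0) (him : (z : ℂ).im = 0) : False :=
  z.coe_ne_zero (Complex.ext hre him)

lemma excess_planarSection_le (z : Circle) (i : Fin 3) :
    excess (planarSection z) i ≤ 2 := by
  have hr := abs_le.1 ((Complex.abs_re_le_norm z).trans_eq z.norm_coe)
  have hi := abs_le.1 ((Complex.abs_im_le_norm z).trans_eq z.norm_coe)
  fin_cases i <;> simp [excess, planarSection]
  · linarith [le_max_left 0 (-(z : ℂ).im)]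
  · linarith [le_max_left (z : ℂ).re (-(z : ℂ).im)]
  · linarith [le_max_right (z : ℂ).re 0]

variable {ε : ℝ} {f : C(letterY, ℂ)} {g : C(letterY, ℝ)}

/-- Let `f` map the first arm to the upper half-plane and the other arms to the lower half-plane,
near the centre, and let `g` be negative on the second arm and positive on the third arm. Then the
direction of `f x - 1 + g y`, where `(x, y)` runs through the exchange loop, is homotopic to a
reflection of the circle. -/
lemma homotopic_circleReflection (hε : ε ∈ Ioc (0 : ℝ) (1 / 2)) (hf : f letterY.center = 1)
    (hfa : ∀ y : letterY, (∀ i, y.1 i ≤ 2 * ε) → y.1 1 = 0 → y.1 2 = 0 → 0 ≤ (f y).im)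
    (hfb : ∀ y : letterY, (∀ i, y.1 i ≤ 2 * ε) → y.1 0 = 0 → (f y).im ≤ 0)
    (hgb : ∀ y : letterY, (∀ i, y.1 i ≤ 2 * ε) → 0 < y.1 1 → g y < 0)
    (hgc : ∀ y : letterY, (∀ i, y.1 i ≤ 2 * ε) → 0 < y.1 2 → 0 < g y)
    (N : C(Circle, ℂ)) (hN : ∀ z, N z ≠ 0)
    (hNfg : ∀ z, N z = f ((exchangeLoop hε z).1 0) - 1 + g ((exchangeLoop hε z).1 1)) :
    (normalizeToCircle N hN).Homotopic circleReflection := by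
  -- The sign of the imaginary part of `N₁` tells whether the first particle is on the first arm, at
  -- the centre, or elsewhere; there, the imaginary part of `N` does not have the opposite sign.
  let N₁ : C(Circle, ℂ) := ⟨fun z => (((z : ℂ).im : ℝ) : ℂ) +
    (((z : ℂ).re - max 0 (-(z : ℂ).im) : ℝ) : ℂ) * Complex.I, by fun_prop⟩
  let N₂ : C(Circle, ℂ) := ⟨fun z => (circleReflection z : ℂ), by fun_prop⟩
  have hN₁re (z) : (N₁ z).re = (z : ℂ).im := by simp [N₁]
  have hN₁im (z) : (N₁ z).im = (z : ℂ).re - max 0 (-(z : ℂ).im) := by simp [N₁]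
  have hN₂re (z) : (N₂ z).re = (z : ℂ).im := congrArg Complex.re (coe_circleReflection z)
  have hN₂im (z) : (N₂ z).im = (z : ℂ).re := congrArg Complex.im (coe_circleReflection z)
  have hN₁ (z) : N₁ z ≠ 0 := by
    intro h
    have hre := hN₁re z
    have him := hN₁im z
    rw [h, Complex.zero_re] at hre
    rw [h, ← hre, Complex.zero_im, neg_zero, max_self, sub_zero] at him
    exact circle_re_im_ne_zero z him.symm hre.symm
  have hN₂ (z) : N₂ z ≠ 0 := (circleReflection z).coe_ne_zero
  have hnorm : normalizeToCircle N₂ hN₂ = circleReflection := by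
    ext z
    rw [coe_normalizeToCircle, show ‖N₂ z‖ = 1 from (circleReflection z).norm_coe]
    simp [N₂]
  rw [← hnorm]
  refine (homotopic_normalizeToCircle hN hN₁ fun z t ht h => ?_).trans
    (homotopic_normalizeToCircle hN₁ hN₂ fun z t ht h => ?_)
  · have hre := congrArg Complex.re h
    have him := congrArg Complex.im h
    have hsmall (z : Circle) (i) : ε * excess (planarSection z) i ≤ 2 * ε := by
      rw [mul_comm 2]
      exact mul_le_mul_of_nonneg_left (excess_planarSection_le z i) hε.1.le
    have hx (i) : ((exchangeLoop hε z).1 0).1 i ≤ 2 * ε := hsmall z i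
    have hy (i) : ((exchangeLoop hε z).1 1).1 i ≤ 2 * ε := hsmall (-z) i
    have hNim : (N z).im = (f ((exchangeLoop hε z).1 0)).im := by
      rw [hNfg]
      simp
    simp only [Complex.add_im, Complex.mul_im, Complex.add_re, Complex.mul_re, Complex.sub_re,
      Complex.sub_im, Complex.one_re, Complex.one_im, Complex.ofReal_re, Complex.ofReal_im,
      sub_zero, zero_mul, add_zero, Complex.zero_im, Complex.zero_re, hN₁re, hN₁im, hNim] at hre him
    obtain ⟨ht0, ht1⟩ := ht
    have hx0 : ((exchangeLoop hε z).1 0).1 = ε • excess (planarSection z) := rfl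
    have hy0 : ((exchangeLoop hε z).1 1).1 = ε • excess (planarSection (-z)) := rfl
    -- If the imaginary part of `N₁` vanishes, the first particle is at the centre, and the sign of
    -- `g` at the second particle is that of the real part of `N₁`.
    rcases lt_trichotomy ((z : ℂ).re - max 0 (-(z : ℂ).im)) 0 with hlt | heq | hgt
    · have := hfb _ hx (by simp [hx0, excess, planarSection, hlt.le])
      nlinarith
    · have hcenter : (exchangeLoop hε z).1 0 = letterY.center := by
        apply Subtype.ext
        rw [hx0]
        ext i
        fin_cases i <;> simp [excess, planarSection, letterY.center] <;> grind
      have hNre : (N z).re = g ((exchangeLoop hε z).1 1) := by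
        rw [hNfg, hcenter, hf]
        simp
      rw [hNre] at hre
      rcases lt_trichotomy (z : ℂ).im 0 with hw | hw | hw
      · rw [max_eq_right (by linarith)] at heq
        have := hgb _ hy (by
          rw [hy0]
          refine mul_pos hε.1 ?_
          simp [excess, planarSection]
          constructor <;> linarith)
        nlinarith
      · rw [hw] at heq
        exact circle_re_im_ne_zero z (by simpa using heq) hw
      · rw [max_eq_left (by linarith)] at heq
        have := hgc _ hy (by
          rw [hy0]
          refine mul_pos hε.1 ?_
          simp [excess, planarSection]
          constructor <;> linarith)
        nlinarith
    · have hmax := le_max_left 0 (-(z : ℂ).im)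
      have hmax' := le_max_right 0 (-(z : ℂ).im)
      have := hfa _ hx
        (by simp [hx0, excess, planarSection, hε.1.ne']; left; linarith)
        (by simp [hx0, excess, planarSection, hε.1.ne']; left; linarith)
      nlinarith
  · have hre := congrArg Complex.re h
    have him := congrArg Complex.im h
    simp only [Complex.add_im, Complex.mul_im, Complex.add_re, Complex.mul_re, Complex.sub_re,
      Complex.sub_im, Complex.one_re, Complex.one_im, Complex.ofReal_re, Complex.ofReal_im,
      sub_zero, zero_mul, add_zero, Complex.zero_im, Complex.zero_re, hN₁re, hN₁im, hN₂re,
      hN₂im] at hre him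
    have hw : (z : ℂ).im = 0 := by linarith
    rw [hw] at him
    refine circle_re_im_ne_zero z ?_ hw
    simp at him
    linarith

end Degree

/-! ### The arms of an embedded letter Y -/

namespace letterY

/-- The point at distance `r` from the centre, on an arm of the letter Y. -/
def arm (i : Fin 3) (r : ℝ) : letterY :=
  ⟨Pi.single i (projIcc (0 : ℝ) 1 zero_le_one r), i, _, (projIcc (0 : ℝ) 1 zero_le_one r).2, rfl⟩

lemma continuous_arm (i : Fin 3) : Continuous (arm i) := by
  have : Continuous fun r => ((projIcc (0 : ℝ) 1 zero_le_one r : Icc (0 : ℝ) 1) : ℝ) :=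
    continuous_subtype_val.comp continuous_projIcc
  exact Continuous.subtype_mk ((continuous_single i).comp this) _

lemma coe_arm (i : Fin 3) {r : ℝ} (hr : r ∈ Icc (0 : ℝ) 1) : (arm i r).1 = Pi.single i r := by
  have h := congrArg Subtype.val (projIcc_of_mem (zero_le_one (α := ℝ)) hr)
  exact congrArg (fun t : ℝ => (Pi.single i t : Fin 3 → ℝ)) h

lemma arm_zero (i : Fin 3) : arm i 0 = center :=
  Subtype.ext (by rw [coe_arm i (by simp), Pi.single_zero]; rfl)

lemma exists_eq_arm (y : letterY) : ∃ i, ∃ r ∈ Icc (0 : ℝ) 1, y = arm i r := by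
  obtain ⟨y, i, r, hr, rfl⟩ := y
  exact ⟨i, r, hr, Subtype.ext (coe_arm i hr).symm⟩

/-- A point of the letter Y with a positive coordinate is on the corresponding arm. -/
lemma eq_arm_of_pos {y : letterY} {i : Fin 3} (h : 0 < y.1 i) :
    y.1 i ∈ Ioc (0 : ℝ) 1 ∧ y = arm i (y.1 i) := by
  obtain ⟨j, r, hr, rfl⟩ := exists_eq_arm y
  rw [coe_arm j hr] at h ⊢
  rcases eq_or_ne i j with rfl | hij
  · rw [Pi.single_eq_same] at h ⊢
    exact ⟨⟨h, hr.2⟩, rfl⟩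
  · rw [Pi.single_eq_of_ne hij] at h
    exact h.false.elim

/-- A point of the letter Y is the centre or on an arm. -/
lemma eq_center_or_exists_pos (y : letterY) : y = center ∨ ∃ i, 0 < y.1 i := by
  obtain ⟨i, r, hr, rfl⟩ := exists_eq_arm y
  rcases hr.1.eq_or_lt with rfl | h
  · exact Or.inl (arm_zero i)
  · exact Or.inr ⟨i, by rwa [coe_arm i hr, Pi.single_eq_same]⟩

lemma eq_of_arm_eq_arm {i j : Fin 3} {r s : ℝ} (hr : r ∈ Ioc (0 : ℝ) 1) (hs : s ∈ Icc (0 : ℝ) 1)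
    (h : arm i r = arm j s) : i = j := by
  have h' := congrFun (congrArg Subtype.val h) i
  rw [coe_arm i ⟨hr.1.le, hr.2⟩, coe_arm j hs, Pi.single_eq_same] at h'
  by_contra hij
  rw [Pi.single_eq_of_ne hij] at h'
  exact hr.1.ne' h'

lemma arm_ne_center {i : Fin 3} {r : ℝ} (hr : r ∈ Ioc (0 : ℝ) 1) : arm i r ≠ center := by
  intro h
  have h' := congrFun (congrArg Subtype.val h) i
  rw [coe_arm i ⟨hr.1.le, hr.2⟩, Pi.single_eq_same] at h'
  exact hr.1.ne' h'

lemma comp_mem {x : Fin 3 → ℝ} (hx : x ∈ letterY) (e : Equiv.Perm (Fin 3)) : x ∘ e ∈ letterY := by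
  rw [mem_letterY_iff] at *
  exact ⟨fun i => hx.1 _, fun i j hij => hx.2 _ _ (e.injective.ne hij)⟩

/-- The permutation of the arms of the letter Y. -/
def permute (e : Equiv.Perm (Fin 3)) : letterY ≃ₜ letterY where
  toFun y := ⟨y.1 ∘ e, comp_mem y.2 e⟩
  invFun y := ⟨y.1 ∘ e.symm, comp_mem y.2 e.symm⟩
  left_inv y := Subtype.ext (by ext i; simp)
  right_inv y := Subtype.ext (by ext i; simp)
  continuous_toFun := by
    refine Continuous.subtype_mk (continuous_pi fun i => ?_) _
    exact (continuous_apply (e i)).comp continuous_subtype_val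
  continuous_invFun := by
    refine Continuous.subtype_mk (continuous_pi fun i => ?_) _
    exact (continuous_apply (e.symm i)).comp continuous_subtype_val

lemma permute_center (e : Equiv.Perm (Fin 3)) : permute e center = center := rfl

lemma permute_arm (e : Equiv.Perm (Fin 3)) (i : Fin 3) {r : ℝ} (hr : r ∈ Icc (0 : ℝ) 1) :
    permute e (arm (e i) r) = arm i r := by
  apply Subtype.ext
  change (arm (e i) r).1 ∘ e = _
  rw [coe_arm _ hr, coe_arm _ hr]
  ext j
  rcases eq_or_ne j i with rfl | h
  · simp
  · simp [h]

end letterY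

section Arms

open letterY

variable {X : Type} [TopologicalSpace X] {v : X} {A : Set X} {φ : letterY ≃ₜ A}

lemma continuous_coe_arm (φ : letterY ≃ₜ A) (i : Fin 3) :
    Continuous fun r => (φ (arm i r) : X) :=
  continuous_subtype_val.comp (φ.continuous.comp (continuous_arm i))

lemma coe_arm_ne (hφ : (φ center : X) = v) {i : Fin 3} {r : ℝ} (hr : r ∈ Ioc (0 : ℝ) 1) :
    (φ (arm i r) : X) ≠ v := fun h =>
  arm_ne_center hr (φ.injective (Subtype.ext (h.trans hφ.symm)))

lemma connectedComponentIn_arm (hφ : (φ center : X) = v) (i : Fin 3) {r s : ℝ}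
    (hr : r ∈ Ioc (0 : ℝ) 1) (hs : s ∈ Ioc (0 : ℝ) 1) :
    connectedComponentIn ({v}ᶜ : Set X) (φ (arm i r)) =
      connectedComponentIn ({v}ᶜ : Set X) (φ (arm i s)) := by
  refine connectedComponentIn_eq (IsPreconnected.subset_connectedComponentIn
    (isPreconnected_Ioc.image _ (continuous_coe_arm φ i).continuousOn) (mem_image_of_mem _ hr) ?_
      (mem_image_of_mem _ hs))
  rintro _ ⟨t, ht, rfl⟩
  exact coe_arm_ne hφ ht

/-- The arms of a Y-graph that meets two components can be labelled in such a way that the second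
and the third arm are in different components. -/
lemma exists_homeomorph_separating (hA : IsYGraphAround A v) (hm : MeetsTwoComponents A v) :
    ∃ φ : letterY ≃ₜ A, (φ center : X) = v ∧
      connectedComponentIn ({v}ᶜ : Set X) (φ (arm 1 1)) ≠
        connectedComponentIn ({v}ᶜ : Set X) (φ (arm 2 1)) := by
  obtain ⟨φ, hφ⟩ := hA
  have hone : (1 : ℝ) ∈ Ioc (0 : ℝ) 1 := by norm_num
  have hend : ∀ a ∈ A \ {v}, ∃ i, connectedComponentIn ({v}ᶜ : Set X) a =
      connectedComponentIn ({v}ᶜ : Set X) (φ (arm i 1)) := by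
    rintro a ⟨ha, hav⟩
    obtain ⟨y, hy⟩ := φ.surjective ⟨a, ha⟩
    rcases eq_center_or_exists_pos y with rfl | ⟨i, hi⟩
    · rw [hy] at hφ
      exact (hav hφ).elim
    · obtain ⟨hr, hy'⟩ := eq_arm_of_pos hi
      refine ⟨i, ?_⟩
      rw [← connectedComponentIn_arm hφ i hr hone, ← hy', hy]
  obtain ⟨a, ha, b, hb, hab⟩ := hm
  obtain ⟨i, hi⟩ := hend a ha
  obtain ⟨j, hj⟩ := hend b hb
  rw [hi, hj] at hab
  have hij : i ≠ j := by
    rintro rfl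
    exact hab rfl
  have hperm : ∀ i j : Fin 3, i ≠ j → ∃ e : Equiv.Perm (Fin 3), e 1 = i ∧ e 2 = j := by decide
  obtain ⟨e, rfl, rfl⟩ := hperm i j hij
  have harm (k : Fin 3) : (permute e).symm (arm k 1) = arm (e k) 1 := by
    rw [Homeomorph.symm_apply_eq, permute_arm e k (by norm_num)]
  have hcenter : (permute e).symm letterY.center = letterY.center := by
    rw [Homeomorph.symm_apply_eq, permute_center]
  refine ⟨(permute e).symm.trans φ, ?_, ?_⟩
  · rw [Homeomorph.trans_apply, hcenter, hφ]
  · rwa [Homeomorph.trans_apply, Homeomorph.trans_apply, harm, harm]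

variable [T2Space X] {H : Type} {P : H → ℝ → X} {V E : Set X}

/-- Near the centre, the arms of a Y-graph run in different rays of a star. -/
lemma IsStar.exists_rays (hS : IsStar v P V E) (hφ : (φ center : X) = v) :
    ∃ ε ∈ Ioc (0 : ℝ) (1 / 2), ∃ k : Fin 3 → H, Function.Injective k ∧
      ∀ i, ∀ r ∈ Ioc (0 : ℝ) (2 * ε), (φ (arm i r) : X) ∈ P (k i) '' Ioo 0 1 := by
  have hzero (i) : (φ (arm i 0) : X) = v := by rw [arm_zero, hφ]
  have hev : ∀ᶠ r in 𝓝 (0 : ℝ), ∀ i, (φ (arm i r) : X) ∈ ({v} ∪ ⋃ h, P h '' Ioo 0 1 : Set X) := by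
    refine Filter.eventually_all.2 fun i => (continuous_coe_arm φ i).continuousAt.eventually_mem ?_
    refine hS.isOpen_star.mem_nhds ?_
    rw [hzero]
    exact Or.inl rfl
  obtain ⟨δ, hδ, hball⟩ := Metric.eventually_nhds_iff.1 hev
  have hε : min (1 / 2) (δ / 4) ∈ Ioc (0 : ℝ) (1 / 2) :=
    ⟨lt_min (by norm_num) (by positivity), min_le_left _ _⟩
  have hεδ : 2 * min (1 / 2) (δ / 4) < δ := by linarith [min_le_right (1 / 2) (δ / 4)]
  generalize min (1 / 2) (δ / 4) = ε at hε hεδ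
  have hle {r : ℝ} (hr : r ∈ Ioc 0 (2 * ε)) : r ∈ Ioc (0 : ℝ) 1 := ⟨hr.1, by linarith [hr.2, hε.2]⟩
  have hmem : 2 * ε ∈ Ioc 0 (2 * ε) := ⟨by linarith [hε.1], le_rfl⟩
  have hray (i : Fin 3) : ∃ h, (fun r => (φ (arm i r) : X)) '' Ioc 0 (2 * ε) ⊆ P h '' Ioo 0 1 := by
    refine hS.exists_ray (isPreconnected_Ioc.image _ (continuous_coe_arm φ i).continuousOn)
      ⟨_, mem_image_of_mem _ hmem⟩ ?_
    rintro _ ⟨r, hr, rfl⟩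
    refine (hball ?_ i).resolve_left (coe_arm_ne hφ (hle hr))
    rw [Real.dist_eq, sub_zero, abs_of_pos hr.1]
    linarith [hr.2]
  choose k hk using hray
  have hk' (i r) (hr : r ∈ Ioc (0 : ℝ) (2 * ε)) : (φ (arm i r) : X) ∈ P (k i) '' Ioo 0 1 :=
    hk i (mem_image_of_mem _ hr)
  -- An arm covers an initial segment of its ray, and disjoint arms cannot cover the same segment.
  have hsegment (i : Fin 3) : ∃ s₀ ∈ Ioo (0 : ℝ) 1,
      P (k i) '' Ioo 0 s₀ ⊆ (fun r => (φ (arm i r) : X)) '' Icc 0 (2 * ε) := by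
    obtain ⟨s₀, hs₀, heq⟩ := hk' i _ hmem
    refine ⟨s₀, hs₀, hS.segment_subset
      (isPreconnected_Icc.image _ (continuous_coe_arm φ i).continuousOn)
      ⟨0, by simp [hε.1.le], hzero i⟩ hs₀ ⟨2 * ε, by simp [hε.1.le], heq.symm⟩ ?_⟩
    rintro ⟨r, hr, h⟩
    rcases hr.1.eq_or_lt with rfl | hr0
    · exact hS.one_ne (k i) (h.symm.trans (hzero i))
    · obtain ⟨s, hs, hs'⟩ := hk' i r ⟨hr0, hr.2⟩
      exact hS.notMem_vertices _ s hs (hs'.trans h ▸ hS.one_mem (k i))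
  refine ⟨ε, hε, k, fun i j hij => ?_, hk'⟩
  obtain ⟨s, hs, hi⟩ := hsegment i
  obtain ⟨s', hs', hj⟩ := hsegment j
  rw [← hij] at hj
  have hmin : 0 < min s s' := lt_min hs.1 hs'.1
  have hss : min s s' / 2 ∈ Ioo (0 : ℝ) 1 :=
    ⟨by linarith, by linarith [min_le_left s s', hs.2]⟩
  obtain ⟨r, hr, h1⟩ := hi ⟨min s s' / 2, ⟨hss.1, by linarith [min_le_left s s']⟩, rfl⟩
  obtain ⟨r', hr', h2⟩ := hj ⟨min s s' / 2, ⟨hss.1, by linarith [min_le_right s s']⟩, rfl⟩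
  have hr0 : 0 < r := by
    refine hr.1.lt_of_ne ?_
    rintro rfl
    exact hS.center_ne _ hss (h1.symm.trans (hzero i))
  refine eq_of_arm_eq_arm (hle ⟨hr0, hr.2⟩) (s := r') ⟨hr'.1, by linarith [hr'.2, hε.2]⟩
    (φ.injective (Subtype.ext (h1.trans h2.symm)))

end Arms

/-! ### Detecting the exchange of two particles -/

/-- The homeomorphism of configuration spaces induced by a homeomorphism. -/
def Conf.homeomorph (n : ℕ) {X Y : Type} [TopologicalSpace X] [TopologicalSpace Y] (φ : X ≃ₜ Y) :
    Conf n X ≃ₜ Conf n Y where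
  toFun x := ⟨fun i => φ (x.1 i), φ.injective.comp x.2⟩
  invFun x := ⟨fun i => φ.symm (x.1 i), φ.symm.injective.comp x.2⟩
  left_inv x := Subtype.ext (by ext i; simp)
  right_inv x := Subtype.ext (by ext i; simp)
  continuous_toFun := Continuous.subtype_mk (continuous_pi fun i =>
    φ.continuous.comp ((continuous_apply i).comp continuous_subtype_val)) _
  continuous_invFun := Continuous.subtype_mk (continuous_pi fun i =>
    φ.symm.continuous.comp ((continuous_apply i).comp continuous_subtype_val)) _

section Exchange

open letterY

variable {X : Type} [TopologicalSpace X] {v : X} {A : Set X} {φ : letterY ≃ₜ A} {H : Type}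
  {P : H → ℝ → X} {V E : Set X}

/-- Rays that start in different components of the complement of `v` have different ends after the
components of the rest have been collapsed. -/
lemma IsStar.proj_one_ne (hS : IsStar v P V E) {h h' : H} {s s' : ℝ} (hs : s ∈ Ioo (0 : ℝ) 1)
    (hs' : s' ∈ Ioo (0 : ℝ) 1) (hne : connectedComponentIn ({v}ᶜ : Set X) (P h s) ≠
      connectedComponentIn ({v}ᶜ : Set X) (P h' s')) :
    Collapse.proj E (P h 1) ≠ Collapse.proj E (P h' 1) := by
  have hone (h : H) {s : ℝ} (hs : s ∈ Ioo (0 : ℝ) 1) :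
      connectedComponentIn ({v}ᶜ : Set X) (P h s) =
        connectedComponentIn ({v}ᶜ : Set X) (P h 1) := by
    refine connectedComponentIn_eq (IsPreconnected.subset_connectedComponentIn
      (isPreconnected_Ioc.image _ ((hS.continuousOn h).mono Ioc_subset_Icc_self))
      (mem_image_of_mem _ ⟨hs.1, hs.2.le⟩) ?_ (mem_image_of_mem _ (right_mem_Ioc.2 zero_lt_one)))
    rintro _ ⟨t, ht, rfl⟩
    rcases ht.2.eq_or_lt with rfl | ht1
    · exact hS.one_ne h
    · exact hS.center_ne h ⟨ht.1, ht1⟩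
  rw [hone h hs, hone h' hs'] at hne
  intro heq
  rcases Collapse.proj_eq_iff.1 heq with heq | ⟨hx, hy, heq⟩
  · exact hne (by rw [heq])
  · refine hne (connectedComponentIn_eq ?_)
    refine connectedComponentIn_mono _ (fun z hz => ?_) (heq ▸ mem_connectedComponentIn hy)
    rintro rfl
    exact hS.center_notMem hz

/-- The class of the exchange loop in the configuration space with sinks is detected by a map to the
circle. -/
lemma IsStar.exists_detectingMap [T2Space X] [CompactSpace X] (hS : IsStar v P V E)
    (hEV : ∀ x ∈ E, ∃ w ∈ V, w ∈ E ∧ connectedComponentIn E x = connectedComponentIn E w)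
    (hφ : (φ center : X) = v) (hsep : connectedComponentIn ({v}ᶜ : Set X) (φ (arm 1 1)) ≠
      connectedComponentIn ({v}ᶜ : Set X) (φ (arm 2 1)))
    (W : Set (Collapse E)) (hW : Collapse.proj E v ∉ W)
    (hq : ∀ x y, x ≠ y → Collapse.proj E x = Collapse.proj E y → Collapse.proj E x ∈ W) :
    ∃ (ε : ℝ) (hε : ε ∈ Ioc (0 : ℝ) (1 / 2)) (F : C(ConfSink 2 (Collapse E) W, Circle)),
      (F.comp ((Conf.toSink 2 (Collapse.proj E) W hq).comp ((Conf.incl 2 A).comp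
        ((Conf.homeomorph 2 φ : C(Conf 2 letterY, Conf 2 A)).comp (exchangeLoop hε))))).Homotopic
          circleReflection := by
  have := Collapse.t2Space hS.isClosed_rest hS.finite_vertices hEV
  have hSQ := hS.collapse hEV
  obtain ⟨ε, hε, k, hk, hray⟩ := hS.exists_rays hφ
  have hne : Collapse.proj E (P (k 1) 1) ≠ Collapse.proj E (P (k 2) 1) := by
    have hmem : 2 * ε ∈ Ioc 0 (2 * ε) := ⟨by linarith [hε.1], le_rfl⟩
    have hmem' : 2 * ε ∈ Ioc (0 : ℝ) 1 := ⟨by linarith [hε.1], by linarith [hε.2]⟩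
    obtain ⟨s, hs, h1⟩ := hray 1 _ hmem
    obtain ⟨s', hs', h2⟩ := hray 2 _ hmem
    refine hS.proj_one_ne hs hs' ?_
    rw [h1, h2, connectedComponentIn_arm hφ 1 hmem' (s := 1) (by norm_num),
      connectedComponentIn_arm hφ 2 hmem' (s := 1) (by norm_num)]
    exact hsep
  obtain ⟨σ, t, hσ, hσv, ht, htv, hσa, hσb, htc, htb⟩ := hSQ.exists_detecting (k 0) (k 2)
  let N : C(ConfSink 2 (Collapse E) W, ℂ) :=
    ⟨fun c => σ (c.1 0) - 1 + (t (c.1 1) : ℂ), by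
      have h (i : Fin 2) : Continuous fun c : ConfSink 2 (Collapse E) W => c.1 i :=
        (continuous_apply i).comp continuous_subtype_val
      exact ((σ.continuous.comp (h 0)).sub continuous_const).add
        (Complex.continuous_ofReal.comp (t.continuous.comp (h 1)))⟩
  have hN (c) : N c ≠ 0 := by
    intro h
    obtain ⟨h0, h1⟩ := eq_center_of_add_eq_zero hσ hσv ht htv h
    rcases c.2 0 1 (by decide) with hc | ⟨-, hc⟩
    · exact hc (h0.trans h1.symm)
    · exact hW (h0 ▸ hc)
  let j : C(letterY, Collapse E) :=
    (Collapse.proj E).comp ⟨fun y => (φ y : X), continuous_subtype_val.comp φ.continuous⟩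
  have hjc : j center = Collapse.proj E v := congrArg (Collapse.proj E) hφ
  have hj {y : letterY} (hy : ∀ i, y.1 i ≤ 2 * ε) {i : Fin 3} (hi : 0 < y.1 i) :
      ∃ s ∈ Ioo (0 : ℝ) 1, j y = Collapse.proj E (P (k i) s) := by
    obtain ⟨-, harm⟩ := eq_arm_of_pos hi
    obtain ⟨s, hs, h⟩ := hray i _ ⟨hi, hy i⟩
    rw [← harm] at h
    exact ⟨s, hs, congrArg (Collapse.proj E) h.symm⟩
  refine ⟨ε, hε, normalizeToCircle N hN, homotopic_circleReflection hε (f := σ.comp j)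
    (g := t.comp j) ?_ ?_ ?_ ?_ ?_ (N.comp ((Conf.toSink 2 (Collapse.proj E) W hq).comp
      ((Conf.incl 2 A).comp ((Conf.homeomorph 2 φ : C(Conf 2 letterY, Conf 2 A)).comp
        (exchangeLoop hε))))) (fun z => hN _) fun z => rfl⟩
  · exact (hσv _).2 hjc
  · intro y hy h1 h2
    rcases eq_center_or_exists_pos y with rfl | ⟨i, hi⟩
    · rw [ContinuousMap.comp_apply, hjc, (hσv _).2 rfl, Complex.one_im]
    · obtain rfl : i = 0 := by
        fin_cases i
        · rfl
        · exact (hi.ne' h1).elim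
        · exact (hi.ne' h2).elim
      obtain ⟨s, hs, h⟩ := hj hy hi
      rw [ContinuousMap.comp_apply, h]
      exact hσa s (Ioo_subset_Icc_self hs)
  · intro y hy h0
    rcases eq_center_or_exists_pos y with rfl | ⟨i, hi⟩
    · rw [ContinuousMap.comp_apply, hjc, (hσv _).2 rfl, Complex.one_im]
    · obtain ⟨s, hs, h⟩ := hj hy hi
      rw [ContinuousMap.comp_apply, h]
      refine hσb _ (hk.ne ?_) s (Ioo_subset_Icc_self hs)
      rintro rfl
      exact hi.ne' h0
  · intro y hy h1
    obtain ⟨s, hs, h⟩ := hj hy h1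
    rw [ContinuousMap.comp_apply, h, htb _ hne s (Ioo_subset_Icc_self hs)]
    exact neg_lt_zero.2 hs.1
  · intro y hy h2
    obtain ⟨s, hs, h⟩ := hj hy h2
    rw [ContinuousMap.comp_apply, h, htc s (Ioo_subset_Icc_self hs)]
    exact hs.1

end Exchange

/-! ### Injectivity in homology -/

/-- Let `c` be a map out of a space with the homotopy type of the circle. If `c` composed with the
homotopy equivalence is detected by a map to the circle, then `c` is injective on `H_1`. -/
lemma H1.map_injective_of_detected {X Y : Type} [TopologicalSpace X] [TopologicalSpace Y]
    (e : ContinuousMap.HomotopyEquiv Circle X) (c : C(X, Y)) (F : C(Y, Circle))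
    (r : Circle ≃ₜ Circle) (h : (F.comp (c.comp e.toFun)).Homotopic r) :
    Function.Injective (H1.map c) := by
  have hr : Function.Injective (H1.map (F.comp (c.comp e.toFun))) := by
    rw [H1.map_eq_of_homotopic h]
    exact H1.map_injective_of_homotopyEquiv r.toHomotopyEquiv
  rw [H1.map_comp, H1.map_comp] at hr
  intro a b hab
  obtain ⟨a, rfl⟩ := (H1.equiv e).surjective a
  obtain ⟨b, rfl⟩ := (H1.equiv e).surjective b
  have hab' : H1.map c (H1.map e.toFun a) = H1.map c (H1.map e.toFun b) := hab
  rw [hr (congrArg (H1.map F) hab')]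

/-- An injective linear map, as an additive equivalence with its range. Its construction does not
refer to the module structure of the range, for which there is more than one expression. -/
def addEquivRange {M N : Type} [AddCommGroup M] [AddCommGroup N] [Module ℤ M] [Module ℤ N]
    (f : M →ₗ[ℤ] N) (hf : Function.Injective f) : M ≃+ LinearMap.range f :=
  AddEquiv.ofBijective (AddMonoidHom.mk' (fun x => ⟨f x, x, rfl⟩) fun x y =>
    Subtype.ext (map_add f x y))
    ⟨fun _ _ h => hf (congrArg Subtype.val h), by
      rintro ⟨_, x, rfl⟩
      exact ⟨x, rfl⟩⟩

end

theorem mainTheorem5 (G : Type) [TopologicalSpace G] [CWComplex (univ : Set G)]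
    (hG : IsFiniteGraph G) [ConnectedSpace G] (v : G) (hv : IsArticulation v)
    (Gv : Set G) (hGv : IsYGraphAround Gv v) (hmeet : MeetsTwoComponents Gv v) :
    Function.Injective (H1.map (Conf.incl 2 Gv)) ∧
    Nonempty (ContinuousMap.HomotopyEquiv (Conf 2 Gv) Circle) ∧
    ∃ (Q : Type) (_ : TopologicalSpace Q) (_ : CWComplex (univ : Set Q))
      (q : C(G, Q)) (W : Set Q),
      IsFiniteGraph Q ∧
      ∃ hq : IsSinkCollapse v q W,
        Function.Injective
          ((H1.map (Conf.toSink 2 q W hq.mem_sinks)).comp (H1.map (Conf.incl 2 Gv))) ∧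
        Module.rank ℤ (LinearMap.range
          ((H1.map (Conf.toSink 2 q W hq.mem_sinks)).comp (H1.map (Conf.incl 2 Gv)))) = 1 := by
  have := hG.t2
  have := hG.compactSpace
  obtain ⟨φ, hφ, hsep⟩ := exists_homeomorph_separating hGv hmeet
  obtain ⟨hcw, hQ, hq⟩ := exists_cwComplex_isSinkCollapse hG hv.1
  obtain ⟨ε, hε, F, hF⟩ := (isStar_halfEdge hG hv.1).exists_detectingMap
    exists_mem_connectedComponentIn hφ hsep _ (fun h => h.2 rfl) hq.mem_sinks
  let e : ContinuousMap.HomotopyEquiv Circle (Conf 2 Gv) :=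
    (circleHomotopyEquivConfY hε).trans (Conf.homeomorph 2 φ).toHomotopyEquiv
  have hinj : Function.Injective
      ((H1.map (Conf.toSink 2 _ _ hq.mem_sinks)).comp (H1.map (Conf.incl 2 Gv))) := by
    rw [← H1.map_comp]
    exact H1.map_injective_of_detected e _ F circleReflection hF
  refine ⟨Function.Injective.of_comp hinj, ⟨e.symm⟩, _, _, hcw, _, _, hQ, hq, hinj, ?_⟩
  obtain ⟨i⟩ := nonempty_addEquiv_H1_circle
  exact rank_eq_one_of_addEquiv
    ((i.trans (H1.equiv e).toAddEquiv).trans (addEquivRange _ hinj))
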